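/- Let $d\ge 1$, $N=\{1,\dots,d\}$, and for $\boldsymbol x\in\mathbb Z_+^d$ let $\varphi(\boldsymbol x)=\{l\in N: x_l\neq 0\}$. For each $A\subset N$ let $S^A$ be a finite nonempty set, and let $\mathcal L=\{(\boldsymbol X_n,J_n)\}$ be a time-homogeneous Markov chain on $\mathcal S=\bigcup_{\boldsymbol x\in\mathbb Z_+^d}\{\boldsymbol x\}\times S^{\varphi(\boldsymbol x)}$ such that from $(\boldsymbol x,i)$ only states $(\boldsymbol x+\boldsymbol z,j)$ with $\boldsymbol z\in\{-1,0,1\}^d$, $\boldsymbol x+\boldsymbol z\in\mathbb Z_+^d$, $j\in S^{\varphi(\boldsymbol x+\boldsymbol z)}$ can be reached in one step, with probabilities of the form $p_{\boldsymbol z}^{\varphi(\boldsymbol x)\,\varphi(\boldsymbol x+\boldsymbol z)}(i,j)$ (a $d$-dimensional skip-free Markov modulated reflecting random walk). Let $\boldsymbol\alpha(\boldsymbol x,i)=E(\boldsymbol X_{n+1}-\boldsymbol X_n\mid (\boldsymbol X_n,J_n)=(\boldsymbol x,i))$. For nonempty $A\subset N$ and $\boldsymbol x^{N\setminus A}\in\mathbb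 Z_+^{N\setminus A}$, let $(\boldsymbol x^{N\setminus A},\boldsymbol 2^A)\in\mathbb Z_+^d$ be the vector with the coordinates of $\boldsymbol x^{N\setminus A}$ outside $A$ and all coordinates in $A$ equal to $2$. The induced chain $\mathcal L^A$ is the Markov chain on $\mathcal S^A=\bigcup_{\boldsymbol x^{N\setminus A}\in\mathbb Z_+^{N\setminus A}}\{\boldsymbol x^{N\setminus A}\}\times S^{\varphi(\boldsymbol x^{N\setminus A},\boldsymbol 2^A)}$ that goes from $(\boldsymbol x^{N\setminus A},i)$ to $(\boldsymbol x^{N\setminus A}+\boldsymbol z^{N\setminus A},j)$, where $\boldsymbol z^{N\setminus A}\in\{-1,0,1\}^{N\setminus A}$, with probability $$\sum_{\boldsymbol z^A\in\{-1,0,1\}^{A}} p_{(\boldsymbol z^{N\setminus A},\boldsymbol z^A)}^{\varphi(\boldsymbol x^{N\setminus A},\boldsymbol 2^A)\,\varphi(\boldsymbol x^{N\setminus A}+\boldsymbol z^{N\setminus A},\boldsymbol 2^A)}(i,j).$$ Assume that $\mathcal L$ is irreducible and that $\mathcal L^A$ is irreducible for every nonempty $A\subset N$. Let $\mathcal N_p$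 be the set of the nonempty $A\subset N$ for which $\mathcal L^A$ is positive recurrent, and for $A\in\mathcal N_p$, with $\pi^A$ the stationary distribution of $\mathcal L^A$, let $$\boldsymbol a(A)=\sum_{(\boldsymbol x^{N\setminus A},i)\in\mathcal S^A}\boldsymbol\alpha\big((\boldsymbol x^{N\setminus A},\boldsymbol 2^A),i\big)\,\pi^A(\boldsymbol x^{N\setminus A},i)\in\mathbb R^d.$$ Let $\mathcal U$ be the set of the real symmetric positive definite $d\times d$ matrices $U$, with columns $\boldsymbol u_1,\dots,\boldsymbol u_d$, such that $\langle\boldsymbol a(A),\boldsymbol u_j\rangle<0$ for all $A\in\mathcal N_p$ and all $j\in A$. If $\mathcal U\neq\emptyset$, then $\mathcal L$ is positive recurrent. -/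

import Mathlib

open scoped ENNReal NNReal

noncomputable section

/-! ### Time-homogeneous Markov chains on a discrete state space

A chain is given by its transition probabilities `P i j`, the probability to go from `i` to `j`
in one step. -/

/-- The `n`-step transition probabilities `P(Z_n = j | Z_0 = i)`. -/
def stepProb {S : Type*} (P : S → S → ℝ≥0∞) : ℕ → S → S → ℝ≥0∞
  | 0, i, j => Set.indicator {j} 1 i
  | n + 1, i, j => ∑' k, P i k * stepProb P n k j

/-- Every state can be reached from every state with positive probability. -/
def IsIrreducibleChain {S : Type*} (P : S → S → ℝ≥0∞) : Prop :=
  ∀ i j, ∃ n, 0 < stepProb P n i j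

/-- `firstPassageProb P j n i` is the probability, for the chain started in `i`, that the first
time `m ≥ 1` with `Z_m = j` is `m = n`. -/
def firstPassageProb {S : Type*} (P : S → S → ℝ≥0∞) (j : S) : ℕ → S → ℝ≥0∞
  | 0, _ => 0
  | 1, i => P i j
  | n + 2, i => ∑' k : {k : S // k ≠ j}, P i k * firstPassageProb P j (n + 1) k

/-- Every state is positive recurrent: the chain started in `i` returns to `i` with probability
one, and the expected return time is finite. -/
def IsPositiveRecurrentChain {S : Type*} (P : S → S → ℝ≥0∞) : Prop :=
  ∀ i, ∑' n : ℕ, firstPassageProb P i n i = 1 ∧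
    ∑' n : ℕ, (n : ℝ≥0∞) * firstPassageProb P i n i < ∞

/-- `π` is a stationary probability distribution of the chain. -/
def IsStationaryDist {S : Type*} (P : S → S → ℝ≥0∞) (π : S → ℝ≥0∞) : Prop :=
  ∑' i, π i = 1 ∧ ∀ j, ∑' i, π i * P i j = π j

/-- The stationary distribution of a chain; it is used only for irreducible positive recurrent
chains, which have exactly one. -/
def stationaryDist {S : Type*} (P : S → S → ℝ≥0∞) : S → ℝ≥0∞ :=
  Classical.epsilon (IsStationaryDist P)

/-! ### Markov modulated reflecting random walks -/

/-- `φ(x)`: the set of the coordinates at which `x` does not vanish. -/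
def face {d : ℕ} (x : Fin d → ℕ) : Finset (Fin d) :=
  Finset.univ.filter fun l => x l ≠ 0

/-- The points `x + z` of the nonnegative orthant with `z ∈ {-1, 0, 1}^ι`. (Truncated
subtraction is what is wanted here: for `x l = 0` the interval is `{0, 1}`.) -/
def neighbors {ι : Type*} [Fintype ι] [DecidableEq ι] (x : ι → ℕ) : Finset (ι → ℕ) :=
  Fintype.piFinset fun l => Finset.Icc (x l - 1) (x l + 1)

/-- The data of a `d`-dimensional skip-free Markov modulated reflecting random walk.
The background states over the face `A` are `Fin (s A)`, and `p A B z i j` is the probability of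
the transition `(x, i) → (x + z, j)` whenever `φ(x) = A` and `φ(x + z) = B`, for increments
`z ∈ {-1, 0, 1}^d`; the other values of `p` are irrelevant. -/
structure MMRRW (d : ℕ) where
  s : Finset (Fin d) → ℕ
  s_pos : ∀ A, 0 < s A
  p : (A B : Finset (Fin d)) → (Fin d → ℤ) → Fin (s A) → Fin (s B) → ℝ≥0
  sum_eq_one : ∀ (x : Fin d → ℕ) (i : Fin (s (face x))),
    ∑ y ∈ neighbors x, ∑ j : Fin (s (face y)),
      p (face x) (face y) (fun l => (y l : ℤ) - (x l : ℤ)) i j = 1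

namespace MMRRW

variable {d : ℕ} (L : MMRRW d)

/-- The state space: pairs of a point `x` of the orthant and a background state over `φ(x)`. -/
abbrev State : Type := Σ x : Fin d → ℕ, Fin (L.s (face x))

/-- The transition probabilities of the walk. -/
def transition (a b : L.State) : ℝ≥0∞ :=
  if b.1 ∈ neighbors a.1 then
    (L.p (face a.1) (face b.1) (fun l => (b.1 l : ℤ) - (a.1 l : ℤ)) a.2 b.2 : ℝ≥0∞)
  else 0

/-- The conditional mean increment `α_l(x, i)` of the `l`-th coordinate, given the state. -/
def meanStep (a : L.State) (l : Fin d) : ℝ :=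
  ∑ y ∈ neighbors a.1, ∑ j : Fin (L.s (face y)),
    ((y l : ℝ) - (a.1 l : ℝ)) *
      (L.p (face a.1) (face y) (fun k => (y k : ℤ) - (a.1 k : ℤ)) a.2 j : ℝ)

/-- The point whose coordinates in `A` are all `2` and whose other coordinates are those
of `x`. -/
def withTwos (A : Finset (Fin d)) (x : {l : Fin d // l ∉ A} → ℕ) : Fin d → ℕ :=
  fun l => if h : l ∈ A then 2 else x ⟨l, h⟩

/-- The vector with coordinates `u` in `A` and `v` outside `A`. -/
def glue (A : Finset (Fin d)) (u : {l : Fin d // l ∈ A} → ℤ) (v : {l : Fin d // l ∉ A} → ℤ) :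
    Fin d → ℤ :=
  fun l => if h : l ∈ A then u ⟨l, h⟩ else v ⟨l, h⟩

/-- The state space of the induced chain for `A`. -/
abbrev InducedState (A : Finset (Fin d)) : Type :=
  Σ x : {l : Fin d // l ∉ A} → ℕ, Fin (L.s (face (withTwos A x)))

/-- The transition probabilities of the induced chain for `A`: the coordinates in `A` are
treated as if far from the boundary, and their increments are summed out. -/
def inducedTransition (A : Finset (Fin d)) (a b : L.InducedState A) : ℝ≥0∞ :=
  if b.1 ∈ neighbors a.1 then
    ∑ u ∈ Fintype.piFinset (fun _ : {l : Fin d // l ∈ A} => Finset.Icc (-1 : ℤ) 1),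
      (L.p (face (withTwos A a.1)) (face (withTwos A b.1))
        (glue A u fun l => (b.1 l : ℤ) - (a.1 l : ℤ)) a.2 b.2 : ℝ≥0∞)
  else 0

/-- The mean increment vector `a(A)`: the mean of `α` at the points with coordinates `2` in `A`
under the stationary distribution of the induced chain for `A`. -/
def meanIncrement (A : Finset (Fin d)) : Fin d → ℝ :=
  fun l => ∑' a : L.InducedState A,
    L.meanStep ⟨withTwos A a.1, a.2⟩ l * (stationaryDist (L.inducedTransition A) a).toReal

/-- The nonempty sets `A` for which the induced chain is positive recurrent. -/
def positiveRecurrentFaces : Set (Finset (Fin d)) :=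
  {A | A.Nonempty ∧ IsPositiveRecurrentChain (L.inducedTransition A)}

/-- The set of the (symmetric) positive definite matrices `U` with columns `u_j` such that
`⟨a(A), u_j⟩ < 0` for every positive recurrent induced chain `A` and every `j ∈ A`. -/
def feasibleMatrices : Set (Matrix (Fin d) (Fin d) ℝ) :=
  {U | U.PosDef ∧ ∀ A ∈ L.positiveRecurrentFaces, ∀ j ∈ A,
    ∑ l, L.meanIncrement A l * U l j < 0}

end MMRRW

end

/-! ### Invariant measures, return times and uniqueness -/

section InvariantMeasures

variable {S : Type*} {P : S → S → ℝ≥0∞}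

/-! The test function is the quadratic form `f(x) = ⟨x, U x⟩`. Over `T` steps its mean change is `∑
j, 2 * x_j * D_j` up to a bounded error, where `D_j` is the expected sum of `⟨α, u_j⟩` along the
path. Foster's criterion (`isPositiveRecurrentChain_of_drift`) thus applies once some `T` gives `D_j
≤ -1` whenever `x_j > T`: the large coordinates then dominate and the small ones contribute a
bounded amount.

Near a point whose coordinates in `B` exceed `T`, the walk agrees for `T` steps with the induced
chain for `B` (`pot_colDrift_eq`), so the claim concerns the induced chains.
`eventually_pot_inducedColDrift_le` proves it by descending induction on `B`: far out in the induced
chain for `B` some further coordinate is large, so a strictly larger set governs the drift there.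
Only a finite set of states remains.

For that finite set, limits of time averages along ultrafilters are used. Such a limit is an
invariant mean; the mass it leaves on states is `c * π`, with `π` stationary and `c = 0` unless the
chain is positive recurrent (`exists_mass_eq`). The part `c * π` has negative drift by the choice of
`U`, the mass `1 - c` escaping to infinity has negative drift by induction, and `exists_pot_le`
turns this into a bound uniform in the starting state. Foster's criterion is obtained from the same
means. -/

theorem tsum_mul_stepProb_of_invariant {m : S → ℝ≥0∞} (hm : ∀ j, ∑' i, m i * P i j = m j)
    (n : ℕ) (j : S) : ∑' i, m i * stepProb P n i j = m j := by
  classical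
  induction n with
  | zero =>
    rw [tsum_eq_single j]
    · simp [stepProb]
    · intro i hi
      simp [stepProb, hi]
  | succ n ih =>
    simp only [stepProb, ← ENNReal.tsum_mul_left]
    rw [ENNReal.tsum_comm]
    simp only [← mul_assoc, ENNReal.tsum_mul_right, hm, ih]

theorem pos_of_invariant (hirr : IsIrreducibleChain P) {m : S → ℝ≥0∞}
    (hm : ∀ j, ∑' i, m i * P i j = m j) {i : S} (hi : m i ≠ 0) (j : S) : m j ≠ 0 := by
  obtain ⟨n, hn⟩ := hirr i j
  have h : m i * stepProb P n i j ≤ m j := by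
    rw [← tsum_mul_stepProb_of_invariant hm n j]
    exact ENNReal.le_tsum i
  exact (lt_of_lt_of_le (ENNReal.mul_pos hi hn.ne') h).ne'

theorem eq_of_le_of_tsum_eq {f g : S → ℝ≥0∞} (hfg : f ≤ g) (hf : ∑' i, f i ≠ ∞)
    (h : ∑' i, f i = ∑' i, g i) : f = g := by
  by_contra hne
  obtain ⟨i, hi⟩ := Function.ne_iff.mp hne
  exact (ENNReal.tsum_lt_tsum hf hfg (lt_of_le_of_ne (hfg i) hi)).ne h

/-- An irreducible chain has at most one stationary distribution. -/
theorem IsStationaryDist.unique (hirr : IsIrreducibleChain P) (hsum : ∀ s, ∑' k, P s k = 1)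
    {π ρ : S → ℝ≥0∞} (hπ : IsStationaryDist P π) (hρ : IsStationaryDist P ρ) : π = ρ := by
  -- The minimum `ν` satisfies `νP ≤ ν` with equal finite total mass, so it is invariant, and so is
  -- `π - ν`. If `π - ν` were nonzero, irreducibility would make it positive everywhere, giving `ρ <
  -- π` everywhere against equal total masses.
  set ν : S → ℝ≥0∞ := π ⊓ ρ with hν
  have hνπ : ν ≤ π := inf_le_left
  have hνρ : ν ≤ ρ := inf_le_right
  have hνfin : ∑' i, ν i ≠ ∞ :=
    ((ENNReal.tsum_le_tsum hνπ).trans_lt (by rw [hπ.1]; exact ENNReal.one_lt_top)).ne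
  have hle : (fun j => ∑' i, ν i * P i j) ≤ ν := by
    intro j
    refine le_inf ?_ ?_
    · rw [← hπ.2 j]
      exact ENNReal.tsum_le_tsum fun i => by gcongr; exact hνπ i
    · rw [← hρ.2 j]
      exact ENNReal.tsum_le_tsum fun i => by gcongr; exact hνρ i
  have hmass : ∑' j, ∑' i, ν i * P i j = ∑' i, ν i := by
    rw [ENNReal.tsum_comm]
    simp [ENNReal.tsum_mul_left, hsum]
  have hνinv := eq_of_le_of_tsum_eq hle (by rw [hmass]; exact hνfin) hmass
  set a : S → ℝ≥0∞ := π - ν with ha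
  have hadd : ∀ i, a i + ν i = π i := fun i => tsub_add_cancel_of_le (hνπ i)
  have hainv : ∀ j, ∑' i, a i * P i j = a j := by
    intro j
    have h := hπ.2 j
    simp only [← hadd, add_mul] at h
    rw [ENNReal.tsum_add, congrFun hνinv j] at h
    exact (ENNReal.add_left_inj (ENNReal.ne_top_of_tsum_ne_top hνfin j)).mp h
  have hzero : ∀ i, a i = 0 := by
    by_contra hne
    push Not at hne
    obtain ⟨i, hi⟩ := hne
    have hlt : ∀ j, ρ j < π j := by
      intro j
      by_contra hj
      push Not at hj
      refine pos_of_invariant hirr hainv hi j ?_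
      simp [ha, hν, inf_eq_left.mpr hj]
    have := ENNReal.tsum_lt_tsum (f := ρ) (g := π) (by rw [hρ.1]; simp) (fun j => (hlt j).le) (hlt i)
    rw [hρ.1, hπ.1] at this
    exact lt_irrefl _ this
  refine eq_of_le_of_tsum_eq (fun i => ?_) (by rw [hπ.1]; simp) (by rw [hπ.1, hρ.1])
  rw [← hadd i, hzero i, zero_add]
  exact hνρ i

/-- The probability, for the chain started in `s`, to be outside `i` at the times `1, …, n`. -/
noncomputable def avoidProb (P : S → S → ℝ≥0∞) (i : S) : ℕ → S → ℝ≥0∞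
  | 0, _ => 1
  | n + 1, s => ∑' k : {k : S // k ≠ i}, P s k * avoidProb P i n k

theorem tsum_eq_add_tsum_subtype_ne (f : S → ℝ≥0∞) (i : S) :
    ∑' k, f k = f i + ∑' k : {k : S // k ≠ i}, f k := by
  classical
  rw [ENNReal.tsum_eq_add_tsum_ite i]
  congr 1
  refine Eq.trans ?_ (tsum_subtype {k : S | k ≠ i} f).symm
  refine tsum_congr fun k => ?_
  by_cases hk : k = i <;> simp [hk]

theorem avoidProb_eq_add (hsum : ∀ s, ∑' k, P s k = 1) (i : S) (n : ℕ) (s : S) :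
    avoidProb P i n s = firstPassageProb P i (n + 1) s + avoidProb P i (n + 1) s := by
  induction n generalizing s with
  | zero =>
    simp only [avoidProb, firstPassageProb, mul_one]
    rw [← tsum_eq_add_tsum_subtype_ne, hsum]
  | succ n ih =>
    rw [avoidProb, firstPassageProb, avoidProb, ← ENNReal.tsum_add]
    refine tsum_congr fun k => ?_
    rw [ih, mul_add]

theorem sum_firstPassageProb_add_avoidProb (hsum : ∀ s, ∑' k, P s k = 1) (i : S) (n : ℕ) (s : S) :
    ∑ m ∈ Finset.range (n + 1), firstPassageProb P i m s + avoidProb P i n s = 1 := by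
  induction n with
  | zero => simp [firstPassageProb, avoidProb]
  | succ n ih => rw [Finset.sum_range_succ, add_assoc, ← avoidProb_eq_add hsum, ih]

/-- Summation by parts, kept in a truncated form without subtraction: it bounds the mean return time
by the sum of the tails. -/
theorem sum_mul_firstPassageProb_add (hsum : ∀ s, ∑' k, P s k = 1) (i : S) (n : ℕ) (s : S) :
    ∑ m ∈ Finset.range (n + 1), (m : ℝ≥0∞) * firstPassageProb P i m s + n * avoidProb P i n s =
      ∑ m ∈ Finset.range n, avoidProb P i m s := by
  induction n with
  | zero => simp
  | succ n ih =>
    have h := avoidProb_eq_add hsum i n s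
    rw [Finset.sum_range_succ (fun m => avoidProb P i m s), ← ih, Finset.sum_range_succ _ (n + 1),
      h, Nat.cast_succ]
    ring

/-- Under an invariant measure, the first step to some `k ≠ i` carries weight `m k`. The identity
telescopes in `n`. -/
theorem mul_avoidProb_add_tsum {m : S → ℝ≥0∞} (hm : ∀ j, ∑' i, m i * P i j = m j)
    (i : S) (n : ℕ) : m i * avoidProb P i n i + ∑' s, m s * avoidProb P i (n + 1) s =
      ∑' s, m s * avoidProb P i n s := by
  rw [tsum_eq_add_tsum_subtype_ne (fun s => m s * avoidProb P i n s) i]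
  congr 1
  simp only [avoidProb, ← ENNReal.tsum_mul_left]
  rw [ENNReal.tsum_comm]
  simp only [← mul_assoc, ENNReal.tsum_mul_right, hm]

/-- An irreducible chain with a stationary distribution is positive recurrent. -/
theorem IsStationaryDist.isPositiveRecurrentChain (hirr : IsIrreducibleChain P)
    (hsum : ∀ s, ∑' k, P s k = 1) {π : S → ℝ≥0∞} (hπ : IsStationaryDist P π) :
    IsPositiveRecurrentChain P := by
  intro i
  have hpos : π i ≠ 0 := by
    have : ∃ k, π k ≠ 0 := by
      by_contra! h
      have := hπ.1
      simp [h] at this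
    obtain ⟨k, hk⟩ := this
    exact pos_of_invariant hirr hπ.2 hk i
  -- One half of Kac's formula: telescoping shows that `π i` times the sum of the tails of the
  -- return time is at most 1. Summable tails give both a finite mean and, since they tend to zero,
  -- almost sure return.
  have hpart : ∀ n, ∑ m ∈ Finset.range n, π i * avoidProb P i m i +
      ∑' s, π s * avoidProb P i n s = 1 := by
    intro n
    induction n with
    | zero => simp [avoidProb, hπ.1]
    | succ n ih => rw [Finset.sum_range_succ, add_assoc, mul_avoidProb_add_tsum hπ.2, ih]
  have hbound : π i * ∑' m, avoidProb P i m i ≤ 1 := by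
    rw [← ENNReal.tsum_mul_left, ENNReal.tsum_eq_iSup_nat]
    exact iSup_le fun n => by rw [← hpart n]; exact le_self_add
  have hfin : ∑' m, avoidProb P i m i ≠ ∞ := by
    intro h
    rw [h, ENNReal.mul_top hpos] at hbound
    simp at hbound
  constructor
  · have h1 : Filter.Tendsto (fun n => ∑ m ∈ Finset.range (n + 1), firstPassageProb P i m i +
        avoidProb P i n i) Filter.atTop (nhds (∑' m, firstPassageProb P i m i + 0)) :=
      ((ENNReal.tendsto_nat_tsum _).comp (Filter.tendsto_add_atTop_nat 1)).add
        (ENNReal.tendsto_atTop_zero_of_tsum_ne_top hfin)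
    simp only [sum_firstPassageProb_add_avoidProb hsum, add_zero] at h1
    exact tendsto_nhds_unique h1 tendsto_const_nhds
  · refine lt_of_le_of_lt ?_ (lt_top_iff_ne_top.mpr hfin)
    rw [ENNReal.tsum_eq_iSup_nat]
    refine iSup_le fun n => le_trans ?_ (ENNReal.sum_le_tsum (Finset.range n))
    rw [← sum_mul_firstPassageProb_add hsum i n i, Finset.sum_range_succ, add_assoc]
    exact le_self_add

end InvariantMeasures

/-! ### Transition operators of locally finite chains -/

/-- A stochastic kernel for which every state has finitely many successors and predecessors. -/
structure IsLocallyFiniteChain {S : Type*} (P : S → S → ℝ≥0∞) : Prop where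
  tsum_eq_one : ∀ s, ∑' k, P s k = 1
  finite_succ : ∀ s, {k | P s k ≠ 0}.Finite
  finite_pred : ∀ k, {s | P s k ≠ 0}.Finite

namespace IsLocallyFiniteChain

open Filter Topology

variable {S : Type*} {P : S → S → ℝ≥0∞} (hP : IsLocallyFiniteChain P)

theorem ne_top (hP : IsLocallyFiniteChain P) (s k : S) : P s k ≠ ∞ :=
  ENNReal.ne_top_of_tsum_ne_top (by rw [hP.tsum_eq_one]; simp) k

/-- The transition operator `g ↦ (s ↦ E(g(Z_1) | Z_0 = s))`. -/
noncomputable def op : Module.End ℝ (S → ℝ) where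
  toFun g s := ∑ k ∈ (hP.finite_succ s).toFinset, (P s k).toReal * g k
  map_add' g h := by
    ext s
    simp [mul_add, Finset.sum_add_distrib]
  map_smul' c g := by
    ext s
    simp [Finset.mul_sum, mul_left_comm]

theorem op_apply (g : S → ℝ) (s : S) {t : Finset S} (ht : ∀ k, P s k ≠ 0 → k ∈ t) :
    hP.op g s = ∑ k ∈ t, (P s k).toReal * g k := by
  refine Finset.sum_subset (fun k hk => ht k (by simpa using hk)) fun k _ hk => ?_
  simp only [Set.Finite.mem_toFinset, Set.mem_ofPred_eq, not_not] at hk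
  simp [hk]

theorem op_const (c : ℝ) : hP.op (fun _ => c) = fun _ => c := by
  ext s
  have h : ∑ k ∈ (hP.finite_succ s).toFinset, P s k = 1 := by
    rw [← hP.tsum_eq_one s]
    exact (tsum_eq_sum (by simp)).symm
  rw [hP.op_apply _ s (t := (hP.finite_succ s).toFinset) (by simp), ← Finset.sum_mul,
    ← ENNReal.toReal_sum (fun k _ => hP.ne_top s k), h]
  simp

theorem op_le_op {g h : S → ℝ} {s : S} (hgh : ∀ k, P s k ≠ 0 → g k ≤ h k) :
    hP.op g s ≤ hP.op h s := by
  refine Finset.sum_le_sum fun k hk => ?_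
  gcongr
  exact hgh k (by simpa using hk)

theorem op_pow_const (n : ℕ) (c : ℝ) : (hP.op ^ n) (fun _ => c) = fun _ => c := by
  induction n with
  | zero => rfl
  | succ n ih => rw [pow_succ, Module.End.mul_apply, hP.op_const, ih]

theorem op_pow_mono (n : ℕ) {g h : S → ℝ} (hgh : ∀ k, g k ≤ h k) (s : S) :
    (hP.op ^ n) g s ≤ (hP.op ^ n) h s := by
  induction n generalizing s with
  | zero => exact hgh s
  | succ n ih =>
    rw [pow_succ', Module.End.mul_apply, Module.End.mul_apply]
    exact hP.op_le_op fun k _ => ih k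

theorem abs_op_pow_le (n : ℕ) {g : S → ℝ} {C : ℝ} (hg : ∀ k, |g k| ≤ C) (s : S) :
    |(hP.op ^ n) g s| ≤ C := by
  rw [abs_le]
  constructor
  · have := hP.op_pow_mono n (g := fun _ => -C) (fun k => (abs_le.mp (hg k)).1) s
    rwa [hP.op_pow_const] at this
  · have := hP.op_pow_mono n (h := fun _ => C) (fun k => (abs_le.mp (hg k)).2) s
    rwa [hP.op_pow_const] at this

/-- The expected sum of `g` over the times `0, …, n - 1`. -/
noncomputable def pot (n : ℕ) : Module.End ℝ (S → ℝ) := ∑ t ∈ Finset.range n, hP.op ^ t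

theorem pot_apply (n : ℕ) (g : S → ℝ) (s : S) :
    hP.pot n g s = ∑ t ∈ Finset.range n, (hP.op ^ t) g s := by
  simp [pot]

theorem pot_add (m n : ℕ) (g : S → ℝ) :
    hP.pot (m + n) g = hP.pot m g + (hP.op ^ m) (hP.pot n g) := by
  simp only [pot, Finset.sum_range_add, LinearMap.add_apply, LinearMap.sum_apply, map_sum,
    pow_add, Module.End.mul_apply]

theorem pot_mono (n : ℕ) {g h : S → ℝ} (hgh : ∀ k, g k ≤ h k) (s : S) :
    hP.pot n g s ≤ hP.pot n h s := by
  rw [pot_apply, pot_apply]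
  exact Finset.sum_le_sum fun t _ => hP.op_pow_mono t hgh s

theorem pot_const (n : ℕ) (c : ℝ) (s : S) : hP.pot n (fun _ => c) s = n * c := by
  simp [pot_apply, op_pow_const]

theorem abs_pot_le (n : ℕ) {g : S → ℝ} {C : ℝ} (hg : ∀ k, |g k| ≤ C) (s : S) :
    |hP.pot n g s| ≤ n * C := by
  rw [pot_apply]
  refine (Finset.abs_sum_le_sum_abs _ _).trans ?_
  refine (Finset.sum_le_card_nsmul _ _ C fun t _ => hP.abs_op_pow_le t hg s).trans ?_
  simp

/-- Dynkin's formula in discrete time: the sum telescopes. -/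
theorem pot_op_sub (n : ℕ) (g : S → ℝ) : hP.pot n (hP.op g - g) = (hP.op ^ n) g - g := by
  simp only [pot, LinearMap.sum_apply, map_sub]
  simp only [← Module.End.mul_apply, ← pow_succ]
  rw [← Finset.sum_sub_distrib, Finset.sum_range_sub (fun t => (hP.op ^ t) g)]
  simp

theorem op_pot_sub (n : ℕ) (g : S → ℝ) :
    hP.op (hP.pot n g) - hP.pot n g = (hP.op ^ n) g - g := by
  rw [← hP.pot_op_sub, map_sub]
  congr 1
  simp only [pot, LinearMap.sum_apply, map_sum, ← Module.End.mul_apply, ← pow_succ, ← pow_succ']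

/-! ### Invariant means -/

/-- The limit along the ultrafilter `u` of the expected time averages of `g`. -/
noncomputable def mean (u : Ultrafilter ℕ) (s : S) (g : S → ℝ) : ℝ :=
  limUnder (u : Filter ℕ) fun n => (n : ℝ)⁻¹ * hP.pot n g s

variable {u : Ultrafilter ℕ} {s : S}

theorem abs_inv_mul_pot_le (n : ℕ) {g : S → ℝ} {C : ℝ} (hg : ∀ k, |g k| ≤ C) (s : S) :
    |(n : ℝ)⁻¹ * hP.pot n g s| ≤ C := by
  have hC : 0 ≤ C := (abs_nonneg _).trans (hg s)
  rcases Nat.eq_zero_or_pos n with rfl | hn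
  · simpa using hC
  · have hn' : (0 : ℝ) < n := by exact_mod_cast hn
    rw [abs_mul, abs_inv, Nat.abs_cast, inv_mul_le_iff₀ hn']
    exact hP.abs_pot_le n hg s

/-- Along an ultrafilter a sequence in the compact interval `[-C, C]` converges, so `limUnder` is a
true limit for bounded `g`. This is why each later lemma on `mean` carries a bound. -/
theorem tendsto_mean (u : Ultrafilter ℕ) (s : S) {g : S → ℝ} {C : ℝ} (hg : ∀ k, |g k| ≤ C) :
    Tendsto (fun n : ℕ => (n : ℝ)⁻¹ * hP.pot n g s) u (𝓝 (hP.mean u s g)) := by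
  refine tendsto_nhds_limUnder ?_
  obtain ⟨x, -, hx⟩ := (isCompact_Icc (a := -C) (b := C)).ultrafilter_le_nhds
    (u.map fun n : ℕ => (n : ℝ)⁻¹ * hP.pot n g s) (by
      rw [le_principal_iff, Ultrafilter.coe_map, mem_map]
      exact univ_mem' fun n => abs_le.mp (hP.abs_inv_mul_pot_le n hg s))
  exact ⟨x, hx⟩

theorem mean_add {g h : S → ℝ} {C D : ℝ} (hg : ∀ k, |g k| ≤ C) (hh : ∀ k, |h k| ≤ D) :
    hP.mean u s (g + h) = hP.mean u s g + hP.mean u s h := by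
  refine tendsto_nhds_unique (hP.tendsto_mean u s (C := C + D) fun k =>
    (abs_add_le _ _).trans (add_le_add (hg k) (hh k))) ?_
  simpa [mul_add] using (hP.tendsto_mean u s hg).add (hP.tendsto_mean u s hh)

theorem mean_smul (c : ℝ) {g : S → ℝ} {C : ℝ} (hg : ∀ k, |g k| ≤ C) :
    hP.mean u s (c • g) = c * hP.mean u s g := by
  refine tendsto_nhds_unique (hP.tendsto_mean u s (C := |c| * C) fun k => ?_) ?_
  · simp only [Pi.smul_apply, smul_eq_mul, abs_mul]
    exact mul_le_mul_of_nonneg_left (hg k) (abs_nonneg c)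
  · simpa [mul_left_comm] using (hP.tendsto_mean u s hg).const_mul c

theorem mean_mono {g h : S → ℝ} {C D : ℝ} (hg : ∀ k, |g k| ≤ C) (hh : ∀ k, |h k| ≤ D)
    (hgh : ∀ k, g k ≤ h k) : hP.mean u s g ≤ hP.mean u s h :=
  le_of_tendsto_of_tendsto' (hP.tendsto_mean u s hg) (hP.tendsto_mean u s hh) fun n =>
    mul_le_mul_of_nonneg_left (hP.pot_mono n hgh s) (by positivity)

theorem mean_const (hu : ↑u ≤ (atTop : Filter ℕ)) (c : ℝ) : hP.mean u s (fun _ => c) = c := by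
  refine tendsto_nhds_unique (hP.tendsto_mean u s (C := |c|) fun _ => le_rfl) ?_
  refine (tendsto_congr' ?_).mpr tendsto_const_nhds
  filter_upwards [hu (eventually_gt_atTop 0)] with n hn
  have : (n : ℝ) ≠ 0 := by positivity
  rw [hP.pot_const]
  field_simp

/-- The time averages of `g` and `op g` differ by a boundary term of size at most `2C / n`. -/
theorem mean_op (hu : ↑u ≤ (atTop : Filter ℕ)) {g : S → ℝ} {C : ℝ} (hg : ∀ k, |g k| ≤ C) :
    hP.mean u s (hP.op g) = hP.mean u s g := by
  refine tendsto_nhds_unique (hP.tendsto_mean u s (C := C) fun k => by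
    simpa using hP.abs_op_pow_le 1 hg k) ?_
  have h0 : Tendsto (fun n : ℕ => (n : ℝ)⁻¹ * ((hP.op ^ n) g s - g s)) u (𝓝 0) := by
    refine Tendsto.mono_left ?_ hu
    refine squeeze_zero_norm (a := fun n : ℕ => (n : ℝ)⁻¹ * (C + C)) (fun n => ?_) ?_
    · rw [norm_mul, norm_inv, Real.norm_natCast, Real.norm_eq_abs]
      gcongr
      exact (abs_sub _ _).trans (add_le_add (hP.abs_op_pow_le n hg s) (hg s))
    · simpa using (tendsto_inv_atTop_nhds_zero_nat (𝕜 := ℝ)).mul_const (C + C)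
  have h := (hP.tendsto_mean u s hg).add h0
  rw [add_zero] at h
  refine h.congr fun n => ?_
  rw [← mul_add, ← Pi.sub_apply, ← hP.pot_op_sub, map_sub, Pi.sub_apply, add_sub_cancel]

theorem mean_pot (hu : ↑u ≤ (atTop : Filter ℕ)) {g : S → ℝ} {C : ℝ} (hg : ∀ k, |g k| ≤ C)
    (T : ℕ) : hP.mean u s (hP.pot T g) = T * hP.mean u s g := by
  induction T with
  | zero =>
    have : hP.pot 0 g = fun _ => 0 := by ext; simp [pot]
    rw [this, hP.mean_const hu]
    simp
  | succ T ih =>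
    have hT : hP.mean u s ((hP.op ^ T) g) = hP.mean u s g := by
      clear ih
      induction T with
      | zero => rfl
      | succ T ih =>
        rw [pow_succ', Module.End.mul_apply, hP.mean_op hu (hP.abs_op_pow_le T hg), ih]
    have : hP.pot (T + 1) g = hP.pot T g + (hP.op ^ T) g := by
      simp [pot, Finset.sum_range_succ]
    rw [this, hP.mean_add (hP.abs_pot_le T hg) (hP.abs_op_pow_le T hg), ih, hT]
    push_cast
    ring

theorem mean_sum {ι : Type*} (t : Finset ι) (c : ι → ℝ) {g : ι → S → ℝ} {C : ι → ℝ}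
    (hu : ↑u ≤ (atTop : Filter ℕ)) (hg : ∀ i k, |g i k| ≤ C i) :
    hP.mean u s (∑ i ∈ t, c i • g i) = ∑ i ∈ t, c i * hP.mean u s (g i) := by
  classical
  have hb : ∀ t : Finset ι, ∀ k, |(∑ i ∈ t, c i • g i) k| ≤ ∑ i ∈ t, |c i| * C i := by
    intro t k
    rw [Finset.sum_apply]
    refine (Finset.abs_sum_le_sum_abs _ _).trans (Finset.sum_le_sum fun i _ => ?_)
    rw [Pi.smul_apply, smul_eq_mul, abs_mul]
    exact mul_le_mul_of_nonneg_left (hg i k) (abs_nonneg _)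
  induction t using Finset.induction_on with
  | empty => simpa [Pi.zero_def] using hP.mean_const (s := s) hu 0
  | insert a t ha ih =>
    rw [Finset.sum_insert ha, Finset.sum_insert ha, hP.mean_add (C := |c a| * C a) _ (hb t), ih,
      hP.mean_smul _ (hg a)]
    intro k
    simpa using hb {a} k

end IsLocallyFiniteChain

namespace IsLocallyFiniteChain

open Filter Topology

variable {S : Type*} {P : S → S → ℝ≥0∞} (hP : IsLocallyFiniteChain P)
variable {u : Ultrafilter ℕ} {s : S}

/-! ### The mass distribution of an invariant mean -/

theorem abs_indicator_singleton_le (j k : S) : |Set.indicator {j} (1 : S → ℝ) k| ≤ 1 := by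
  by_cases hk : k = j <;> simp [hk]

/-- The limit along the ultrafilter `u` of the expected proportion of time spent in `j`. -/
noncomputable def mass (u : Ultrafilter ℕ) (s j : S) : ℝ :=
  hP.mean u s (Set.indicator {j} 1)

theorem mass_nonneg (hu : ↑u ≤ (atTop : Filter ℕ)) (j : S) : 0 ≤ hP.mass u s j := by
  rw [← hP.mean_const (s := s) hu 0]
  exact hP.mean_mono (C := 0) (by simp) (abs_indicator_singleton_le j)
    fun k => Set.indicator_nonneg (fun _ _ => zero_le_one) k

theorem mean_sum_indicator (hu : ↑u ≤ (atTop : Filter ℕ)) (t : Finset S) (c : S → ℝ) :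
    hP.mean u s (∑ j ∈ t, c j • Set.indicator {j} 1) = ∑ j ∈ t, c j * hP.mass u s j :=
  hP.mean_sum t c hu abs_indicator_singleton_le

theorem sum_smul_indicator_apply [DecidableEq S] (t : Finset S) (c : S → ℝ) (k : S) :
    (∑ j ∈ t, c j • Set.indicator {j} (1 : S → ℝ)) k = if k ∈ t then c k else 0 := by
  have : ∀ j, (c j • Set.indicator {j} (1 : S → ℝ)) k = if k = j then c j else 0 := by
    intro j
    by_cases hk : k = j <;> simp [hk]
  simp only [Finset.sum_apply, this, Finset.sum_ite_eq]

theorem abs_sum_smul_indicator_le (t : Finset S) (c : S → ℝ) (k : S) :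
    |(∑ j ∈ t, c j • Set.indicator {j} (1 : S → ℝ)) k| ≤ ∑ j ∈ t, |c j| := by
  classical
  rw [sum_smul_indicator_apply]
  split_ifs with hk
  · exact Finset.single_le_sum (f := fun j => |c j|) (fun _ _ => abs_nonneg _) hk
  · simpa using Finset.sum_nonneg fun j (_ : j ∈ t) => abs_nonneg (c j)

theorem sum_mass_le_one (hu : ↑u ≤ (atTop : Filter ℕ)) (t : Finset S) :
    ∑ j ∈ t, hP.mass u s j ≤ 1 := by
  classical
  have h := hP.mean_sum_indicator (s := s) hu t fun _ => 1
  simp only [one_mul] at h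
  rw [← h]
  conv_rhs => rw [← hP.mean_const (s := s) hu 1]
  refine hP.mean_mono (abs_sum_smul_indicator_le t _) (C := _) (D := 1) (by simp) fun k => ?_
  rw [sum_smul_indicator_apply]
  split_ifs <;> norm_num

theorem summable_mass (hu : ↑u ≤ (atTop : Filter ℕ)) : Summable (hP.mass u s) :=
  summable_of_sum_le (hP.mass_nonneg hu) (hP.sum_mass_le_one hu)

theorem tsum_mass_le_one (hu : ↑u ≤ (atTop : Filter ℕ)) : ∑' j, hP.mass u s j ≤ 1 :=
  (hP.summable_mass hu).tsum_le_of_sum_le (hP.sum_mass_le_one hu)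

/-- The mean is only finitely additive. As `j` has finitely many predecessors, `op` maps its
indicator to a finite combination of indicators, so no mass is lost in this identity. -/
theorem tsum_mass_mul (hu : ↑u ≤ (atTop : Filter ℕ)) (j : S) :
    ∑' i, ENNReal.ofReal (hP.mass u s i) * P i j = ENNReal.ofReal (hP.mass u s j) := by
  classical
  have hop : hP.op (Set.indicator {j} 1) =
      ∑ i ∈ (hP.finite_pred j).toFinset, (P i j).toReal • Set.indicator {i} (1 : S → ℝ) := by
    ext i
    rw [sum_smul_indicator_apply, hP.op_apply _ i (t := insert j (hP.finite_succ i).toFinset)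
      (fun k hk => by simp [hk]), Finset.sum_eq_single j]
    · by_cases h : P i j = 0 <;> simp [h]
    · intro k _ hk
      simp [hk]
    · simp
  have h1 : hP.mass u s j = ∑ i ∈ (hP.finite_pred j).toFinset, (P i j).toReal * hP.mass u s i := by
    rw [← hP.mean_sum_indicator hu, ← hop, hP.mean_op hu (abs_indicator_singleton_le j), mass]
  rw [h1, ENNReal.ofReal_sum_of_nonneg fun i _ =>
    mul_nonneg ENNReal.toReal_nonneg (hP.mass_nonneg hu i), tsum_eq_sum]
  · refine Finset.sum_congr rfl fun i _ => ?_
    rw [ENNReal.ofReal_mul ENNReal.toReal_nonneg, ENNReal.ofReal_toReal (hP.ne_top i j), mul_comm]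
  · intro i hi
    simp only [Set.Finite.mem_toFinset, Set.mem_ofPred_eq, not_not] at hi
    simp [hi]

/-- The mass of an invariant mean of an irreducible chain is a multiple of the stationary
distribution; it vanishes unless the chain is positive recurrent. -/
theorem exists_mass_eq (hirr : IsIrreducibleChain P) (hu : ↑u ≤ (atTop : Filter ℕ)) :
    ∃ c : ℝ, 0 ≤ c ∧ c ≤ 1 ∧ (∀ j, hP.mass u s j = c * (stationaryDist P j).toReal) ∧
      (c ≠ 0 → IsPositiveRecurrentChain P ∧ IsStationaryDist P (stationaryDist P)) := by
  set m : S → ℝ≥0∞ := fun j => ENNReal.ofReal (hP.mass u s j) with hm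
  set c : ℝ := ∑' j, hP.mass u s j with hc
  have hc0 : 0 ≤ c := tsum_nonneg (hP.mass_nonneg hu)
  have hmc : ∑' j, m j = ENNReal.ofReal c :=
    (ENNReal.ofReal_tsum_of_nonneg (hP.mass_nonneg hu) (hP.summable_mass hu)).symm
  rcases hc0.eq_or_lt with h0 | hpos
  · refine ⟨0, le_rfl, zero_le_one, fun j => ?_, by simp⟩
    have h := (hP.summable_mass hu (s := s)).hasSum
    rw [← hc, ← h0] at h
    rw [zero_mul]
    exact congrFun ((hasSum_zero_iff_of_nonneg (hP.mass_nonneg hu)).mp h) j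
  · have hπ : IsStationaryDist P fun j => (ENNReal.ofReal c)⁻¹ * m j := by
      constructor
      · rw [ENNReal.tsum_mul_left, hmc, ENNReal.inv_mul_cancel (by simpa using hpos) (by simp)]
      · intro j
        simp only [mul_assoc, ENNReal.tsum_mul_left, hm, hP.tsum_mass_mul hu]
    -- The normalised mass witnesses existence, so the `epsilon` choice is itself stationary;
    -- uniqueness then identifies the two.
    have hst : IsStationaryDist P (stationaryDist P) := Classical.epsilon_spec ⟨_, hπ⟩
    refine ⟨c, hc0, hP.tsum_mass_le_one hu, fun j => ?_, fun _ =>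
      ⟨hπ.isPositiveRecurrentChain hirr hP.tsum_eq_one, hst⟩⟩
    rw [hst.unique hirr hP.tsum_eq_one hπ, ENNReal.toReal_mul, ENNReal.toReal_inv,
      ENNReal.toReal_ofReal hc0, ENNReal.toReal_ofReal (hP.mass_nonneg hu j)]
    field_simp

/-- Mass that escapes to infinity sees only `h ≤ 0`: for each finite `G ⊇ F`, cutting `h` off
outside `G` can only increase it, and the mean of the cut-off is a finite sum. -/
theorem mean_le_tsum_mul_mass (hu : ↑u ≤ (atTop : Filter ℕ)) {h : S → ℝ} {C : ℝ}
    (hh : ∀ k, |h k| ≤ C) (F : Finset S) (hF : ∀ k ∉ F, h k ≤ 0) :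
    hP.mean u s h ≤ ∑' j, h j * hP.mass u s j := by
  classical
  have hsm : Summable fun j => h j * hP.mass u s j := by
    refine Summable.of_norm_bounded ((hP.summable_mass hu (s := s)).mul_left C) fun j => ?_
    rw [norm_mul, Real.norm_eq_abs, Real.norm_of_nonneg (hP.mass_nonneg hu j)]
    exact mul_le_mul_of_nonneg_right (hh j) (hP.mass_nonneg hu j)
  refine ge_of_tendsto hsm.hasSum ?_
  filter_upwards [eventually_ge_atTop F] with G hG
  rw [← hP.mean_sum_indicator hu]
  refine hP.mean_mono hh (abs_sum_smul_indicator_le G h) fun k => ?_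
  rw [sum_smul_indicator_apply]
  split_ifs with hk
  · exact le_rfl
  · exact hF k fun hkF => hk (hG hkF)

/-! ### Stationary expectations -/

theorem summable_toReal_of_stationary {π : S → ℝ≥0∞} (hπ : IsStationaryDist P π) {g : S → ℝ}
    {C : ℝ} (hg : ∀ k, |g k| ≤ C) : Summable fun k => g k * (π k).toReal := by
  refine Summable.of_norm_bounded
    ((ENNReal.summable_toReal (f := π) (by rw [hπ.1]; simp)).mul_left C) fun j => ?_
  rw [norm_mul, Real.norm_eq_abs, Real.norm_of_nonneg ENNReal.toReal_nonneg]
  exact mul_le_mul_of_nonneg_right (hg j) ENNReal.toReal_nonneg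

theorem tsum_op_mul_stationary {π : S → ℝ≥0∞} (hπ : IsStationaryDist P π) {g : S → ℝ} {C : ℝ}
    (hg : ∀ k, |g k| ≤ C) :
    ∑' j, hP.op g j * (π j).toReal = ∑' j, g j * (π j).toReal := by
  have hs : Summable fun q : S × S => g q.2 * (π q.1 * P q.1 q.2).toReal := by
    refine Summable.of_norm_bounded ((ENNReal.summable_toReal
      (f := fun q : S × S => π q.1 * P q.1 q.2) ?_).mul_left C) fun q => ?_
    · rw [ENNReal.tsum_prod (f := fun a b => π a * P a b)]
      simp [ENNReal.tsum_mul_left, hP.tsum_eq_one, hπ.1]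
    · rw [norm_mul, Real.norm_eq_abs, Real.norm_of_nonneg ENNReal.toReal_nonneg]
      exact mul_le_mul_of_nonneg_right (hg _) ENNReal.toReal_nonneg
  have h1 : ∀ j, ∑' k, g k * (π j * P j k).toReal = hP.op g j * (π j).toReal := by
    intro j
    rw [hP.op_apply g j (t := (hP.finite_succ j).toFinset) (by simp), Finset.sum_mul, tsum_eq_sum]
    · refine Finset.sum_congr rfl fun k _ => ?_
      rw [ENNReal.toReal_mul]
      ring
    · intro k hk
      simp only [Set.Finite.mem_toFinset, Set.mem_ofPred_eq, not_not] at hk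
      simp [hk]
  have h2 : ∀ k, ∑' j, g k * (π j * P j k).toReal = g k * (π k).toReal := by
    intro k
    rw [tsum_mul_left, ← ENNReal.tsum_toReal_eq, hπ.2 k]
    intro j
    exact ENNReal.mul_ne_top (ENNReal.ne_top_of_tsum_ne_top (by rw [hπ.1]; simp) j)
      (hP.ne_top j k)
  simp only [← h1, ← h2]
  exact Summable.tsum_comm (f := fun k j => g k * (π j * P j k).toReal)
    ((Equiv.prodComm S S).summable_iff.mp hs)

theorem tsum_pot_mul_stationary {π : S → ℝ≥0∞} (hπ : IsStationaryDist P π) {g : S → ℝ} {C : ℝ}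
    (hg : ∀ k, |g k| ≤ C) (n : ℕ) :
    ∑' j, hP.pot n g j * (π j).toReal = n * ∑' j, g j * (π j).toReal := by
  induction n with
  | zero => simp [pot]
  | succ n ih =>
    have hn : hP.pot (n + 1) g = g + hP.op (hP.pot n g) := by
      rw [add_comm n 1, hP.pot_add]
      simp [pot]
    have hb := hP.abs_pot_le n hg
    have hb' : ∀ k, |hP.op (hP.pot n g) k| ≤ n * C := fun k => by
      simpa using hP.abs_op_pow_le 1 hb k
    simp only [hn, Pi.add_apply, add_mul]
    rw [(summable_toReal_of_stationary hπ hg).tsum_add (summable_toReal_of_stationary hπ hb'),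
      hP.tsum_op_mul_stationary hπ hb, ih]
    push_cast
    ring

/-! ### Drift conditions -/

/-- Apply `mean_le_tsum_mul_mass` to `pot T g + 1`. With stationary mean `-κ` and mass `c` on
states, `T * mean g ≤ -((1 - c) + c * T * κ) ≤ -min 1 (T * κ)`. Half of this bound gives a `δ` free
of `u` and `s` and makes the inequality strict. -/
theorem exists_mean_le_of_pot_le (hirr : IsIrreducibleChain P) {g : S → ℝ} {C : ℝ}
    (hg : ∀ k, |g k| ≤ C) {T : ℕ} (hT : 0 < T) (F : Finset S)
    (hF : ∀ k ∉ F, hP.pot T g k ≤ -1)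
    (hst : IsPositiveRecurrentChain P → IsStationaryDist P (stationaryDist P) →
      ∑' k, g k * (stationaryDist P k).toReal < 0) :
    ∃ δ : ℝ, 0 < δ ∧ δ * T ≤ 1 ∧ ∀ (u : Ultrafilter ℕ) (s : S), ↑u ≤ (atTop : Filter ℕ) →
      hP.mean u s g < -δ := by
  obtain ⟨κ, hκ, hκP⟩ : ∃ κ : ℝ, 0 < κ ∧
      (IsPositiveRecurrentChain P ∧ IsStationaryDist P (stationaryDist P) →
        ∑' k, g k * (stationaryDist P k).toReal = -κ) := by
    by_cases h : IsPositiveRecurrentChain P ∧ IsStationaryDist P (stationaryDist P)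
    · exact ⟨_, neg_pos.mpr (hst h.1 h.2), fun _ => (neg_neg _).symm⟩
    -- Here the value of `κ` is arbitrary, since then `c = 0`.
    · exact ⟨1, one_pos, fun h' => absurd h' h⟩
  have hT' : (0 : ℝ) < T := by exact_mod_cast hT
  have hmin : 0 < min 1 (T * κ) := lt_min one_pos (mul_pos hT' hκ)
  refine ⟨min 1 (T * κ) / (2 * T), by positivity, ?_, fun u s hu => ?_⟩
  · have := min_le_left 1 (T * κ)
    have h2 : min 1 (T * κ) / (2 * T) * T = min 1 (T * κ) / 2 := by field_simp
    rw [h2]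
    linarith
  · obtain ⟨c, hc0, hc1, hc, hcP⟩ := hP.exists_mass_eq (s := s) hirr hu
    have hpb := hP.abs_pot_le T hg
    have hone : ∀ k : S, |(fun _ => (1 : ℝ)) k| ≤ 1 := by simp
    have hhb : ∀ k, |(hP.pot T g + fun _ : S => (1 : ℝ)) k| ≤ T * C + 1 := fun k =>
      (abs_add_le _ _).trans (add_le_add (hpb k) (hone k))
    have h1 := hP.mean_le_tsum_mul_mass (s := s) hu hhb F fun k hk => by
      have := hF k hk
      simp only [Pi.add_apply]
      linarith
    rw [hP.mean_add hpb hone, hP.mean_const hu, hP.mean_pot hu hg] at h1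
    have h2 : ∑' j, (hP.pot T g + fun _ : S => (1 : ℝ)) j * hP.mass u s j ≤ c * (1 - T * κ) := by
      by_cases hcz : c = 0
      · simp [hc, hcz]
      · obtain ⟨hpr, hπ⟩ := hcP hcz
        simp only [hc, mul_left_comm _ c, tsum_mul_left, Pi.add_apply, add_mul]
        rw [(summable_toReal_of_stationary hπ hpb).tsum_add
          (summable_toReal_of_stationary hπ hone), hP.tsum_pot_mul_stationary hπ hg, hκP ⟨hpr, hπ⟩]
        simp only [one_mul]
        rw [← ENNReal.tsum_toReal_eq
          (fun j => ENNReal.ne_top_of_tsum_ne_top (by rw [hπ.1]; simp) j), hπ.1,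
          ENNReal.toReal_one]
        exact le_of_eq (by ring)
    have h3 : T * hP.mean u s g ≤ -min 1 (T * κ) := by
      have hl := mul_le_mul_of_nonneg_left (min_le_left 1 (T * κ)) (sub_nonneg.mpr hc1)
      have hr := mul_le_mul_of_nonneg_left (min_le_right 1 (T * κ)) hc0
      linarith
    rw [← neg_div, lt_div_iff₀ (by positivity)]
    linarith

/-- Uniformly negative time averages from a drift condition off a finite set and negative
stationary mean. -/
theorem exists_pot_le (hirr : IsIrreducibleChain P) {g : S → ℝ} {C : ℝ}
    (hg : ∀ k, |g k| ≤ C) {T : ℕ} (hT : 0 < T) (F : Finset S)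
    (hF : ∀ k ∉ F, hP.pot T g k ≤ -1)
    (hst : IsPositiveRecurrentChain P → IsStationaryDist P (stationaryDist P) →
      ∑' k, g k * (stationaryDist P k).toReal < 0) :
    ∃ δ : ℝ, 0 < δ ∧ ∃ K, ∀ (n : ℕ) s, hP.pot n g s ≤ K - δ * n := by
  obtain ⟨δ, hδ, hδT, hmean⟩ := hP.exists_mean_le_of_pot_le hirr hg hT F hF hst
  have hpt : ∀ s, ∃ K, 0 ≤ K ∧ ∀ n, hP.pot n g s ≤ K - δ * n := by
    intro s
    have hC : 0 ≤ C := (abs_nonneg _).trans (hg s)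
    have hev : ∀ᶠ n : ℕ in atTop, hP.pot n g s ≤ -(δ * n) := by
      by_contra hcon
      have hfr : ∃ᶠ n : ℕ in atTop, -(δ * n) < hP.pot n g s := by
        simpa [Filter.Frequently] using hcon
      have hne : NeBot (atTop ⊓ 𝓟 {n : ℕ | -(δ * n) < hP.pot n g s}) :=
        frequently_mem_iff_neBot.mp hfr
      -- If the bound failed for infinitely many `n`, an ultrafilter finer than `atTop` concentrated
      -- on those `n` would have mean at least `-δ`.
      have hle := Ultrafilter.of_le (atTop ⊓ 𝓟 {n : ℕ | -(δ * n) < hP.pot n g s})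
      have hu := hle.trans inf_le_left
      refine absurd (hmean _ s hu) (not_lt.mpr ?_)
      refine ge_of_tendsto (hP.tendsto_mean _ s hg) ?_
      filter_upwards [hu (eventually_gt_atTop 0),
        (hle.trans inf_le_right) (mem_principal_self _)] with n hn hn'
      have hn0 : (0 : ℝ) < n := by exact_mod_cast hn
      rw [le_inv_mul_iff₀ hn0]
      have : -(δ * n) < hP.pot n g s := hn'
      linarith
    obtain ⟨N, hN⟩ := eventually_atTop.mp hev
    refine ⟨N * C + δ * N, by positivity, fun n => ?_⟩
    rcases le_total N n with h | h
    · have := hN n h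
      have : 0 ≤ N * C + δ * N := by positivity
      linarith
    · have h1 := (abs_le.mp (hP.abs_pot_le n hg s)).2
      have hnN : (n : ℝ) ≤ N := by exact_mod_cast h
      have h2 := mul_le_mul_of_nonneg_right hnN hC
      have h3 := mul_le_mul_of_nonneg_left hnN hδ.le
      linarith
  choose K hK0 hK using hpt
  rcases isEmpty_or_nonempty S with hS | ⟨⟨s₀⟩⟩
  · exact ⟨δ, hδ, 0, fun n s => hS.elim s⟩
  have hC : 0 ≤ C := (abs_nonneg _).trans (hg s₀)
  have hT' : (0 : ℝ) < T := by exact_mod_cast hT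
  have hsum0 : 0 ≤ ∑ s ∈ F, K s := Finset.sum_nonneg fun s _ => hK0 s
  refine ⟨δ, hδ, ∑ s ∈ F, K s + T * C + δ * T, fun n => ?_⟩
  -- Uniformity in `s`: on the finite set `F` the pointwise constants suffice; off `F`, the first
  -- `T` steps gain `-1 ≤ -δ * T`, and the induction hypothesis covers the remaining steps from
  -- wherever the chain is.
  induction n using Nat.strong_induction_on with
  | _ n ih =>
    intro s
    have hTC : 0 ≤ T * C := by positivity
    have hδT0 : 0 ≤ δ * T := by positivity
    by_cases hs : s ∈ F
    · have h1 := hK s n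
      have h2 := Finset.single_le_sum (f := K) (fun s _ => hK0 s) hs
      linarith
    · rcases lt_or_ge n T with hn | hn
      · have h1 := (abs_le.mp (hP.abs_pot_le n hg s)).2
        have hnT : (n : ℝ) ≤ T := by exact_mod_cast hn.le
        have h2 := mul_le_mul_of_nonneg_right hnT hC
        have h3 := mul_le_mul_of_nonneg_left hnT hδ.le
        linarith
      · obtain ⟨m, rfl⟩ := Nat.exists_eq_add_of_le hn
        rw [hP.pot_add, Pi.add_apply]
        have h1 := hF s hs
        have h2 := hP.op_pow_mono T (ih m (by omega)) s
        rw [hP.op_pow_const] at h2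
        push_cast
        simp only at h2
        linarith

/-- Foster's criterion for a multi-step drift. -/
theorem isPositiveRecurrentChain_of_drift (hirr : IsIrreducibleChain P) {f : S → ℝ}
    (hf : ∀ k, 0 ≤ f k) (T : ℕ) (F : Finset S) (hF : ∀ k ∉ F, (hP.op ^ T) f k - f k ≤ -1) :
    IsPositiveRecurrentChain P := by
  classical
  intro s
  suffices h : IsPositiveRecurrentChain P from h s
  set u : Ultrafilter ℕ := Ultrafilter.of atTop
  have hu : ↑u ≤ (atTop : Filter ℕ) := Ultrafilter.of_le atTop
  -- The one-step drift of `W` is the `T`-step drift of `f`, that is `op W - W = op ^ T f - f`.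
  set W := hP.pot T f
  have hpow0 : ∀ n {g : S → ℝ}, (∀ k, 0 ≤ g k) → ∀ k, 0 ≤ (hP.op ^ n) g k := by
    intro n g hg k
    have := hP.op_pow_mono n (g := fun _ => 0) hg k
    rwa [hP.op_pow_const] at this
  have hW : ∀ k, 0 ≤ W k := fun k => by
    simp only [W, hP.pot_apply]
    exact Finset.sum_nonneg fun t _ => hpow0 t hf k
  set h : S → ℝ := (hP.op ^ T) f - f
  set c : S → ℝ := fun j => |h j| + 1
  set b : S → ℝ := ∑ j ∈ F, c j • Set.indicator {j} 1
  have hhb : ∀ k, h k ≤ ((fun _ : S => (-1 : ℝ)) + b) k := by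
    intro k
    rw [Pi.add_apply, show b k = _ from sum_smul_indicator_apply F c k]
    split_ifs with hk
    · have := le_abs_self (h k)
      simp only [c]
      linarith
    · rw [add_zero]
      exact hF k hk
  have hn : ∀ n : ℕ, n ≤ W s + hP.pot n b s := by
    intro n
    have h1 := hpow0 n hW s
    have h2 : (hP.op ^ n) W s - W s = hP.pot n h s := by
      rw [← Pi.sub_apply, ← hP.pot_op_sub, hP.op_pot_sub]
    have h3 := hP.pot_mono n hhb s
    rw [map_add, Pi.add_apply, hP.pot_const] at h3
    linarith
  -- Dividing by `n` removes `W s`. So the mean of `b`, which is supported on `F`, is at least 1,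
  -- and the mass on states cannot vanish.
  have hlim : (1 : ℝ) ≤ 0 * W s + hP.mean u s b := by
    refine ge_of_tendsto (((tendsto_inv_atTop_nhds_zero_nat (𝕜 := ℝ)).mono_left hu).mul_const (W s)
      |>.add (hP.tendsto_mean u s (abs_sum_smul_indicator_le F c))) ?_
    filter_upwards [hu (eventually_gt_atTop 0)] with n hn0
    have hn0' : (0 : ℝ) < n := by exact_mod_cast hn0
    rw [← mul_add, le_inv_mul_iff₀ hn0', mul_one]
    exact hn n
  rw [hP.mean_sum_indicator hu] at hlim
  obtain ⟨a, -, -, ha, haP⟩ := hP.exists_mass_eq (s := s) hirr hu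
  refine (haP fun h0 => ?_).1
  simp [ha, h0] at hlim
  linarith

end IsLocallyFiniteChain

/-! ### Local structure of the walk -/

theorem mem_neighbors {ι : Type*} [Fintype ι] [DecidableEq ι] {x y : ι → ℕ} :
    y ∈ neighbors x ↔ ∀ l, x l ≤ y l + 1 ∧ y l ≤ x l + 1 := by
  simp only [neighbors, Fintype.mem_piFinset, Finset.mem_Icc]
  exact forall_congr' fun l => by omega

theorem mem_neighbors_comm {ι : Type*} [Fintype ι] [DecidableEq ι] {x y : ι → ℕ} :
    y ∈ neighbors x ↔ x ∈ neighbors y := by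
  simp only [mem_neighbors]
  exact forall_congr' fun l => by omega

namespace MMRRW

variable {d : ℕ} (L : MMRRW d)

theorem face_congr {x y : Fin d → ℕ} (h : ∀ l, x l ≠ 0 ↔ y l ≠ 0) : face x = face y := by
  ext l
  simp [face, h l]

/-- Equality of faces is only propositional, so background states must be transported between the
types `Fin (L.s A)`. -/
theorem p_cast {A A' B B' : Finset (Fin d)} (hA : A = A') (hB : B = B') (z : Fin d → ℤ)
    (i : Fin (L.s A)) (j : Fin (L.s B)) :
    L.p A' B' z (Fin.cast (congrArg L.s hA) i) (Fin.cast (congrArg L.s hB) j) = L.p A B z i j := by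
  subst hA hB
  rfl

theorem inducedState_ext {A : Finset (Fin d)} {a b : L.InducedState A} (h1 : a.1 = b.1)
    (h2 : (a.2 : ℕ) = b.2) : a = b := by
  obtain ⟨x, i⟩ := a
  obtain ⟨y, j⟩ := b
  obtain rfl : x = y := h1
  exact congrArg (Sigma.mk x) (Fin.ext h2)

theorem face_withTwos_restrict {B : Finset (Fin d)} {x : Fin d → ℕ} (hx : ∀ l ∈ B, x l ≠ 0) :
    face x = face (withTwos B fun l => x l) := by
  refine face_congr fun l => ?_
  by_cases hl : l ∈ B
  · simp [withTwos, hl, hx l hl]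
  · simp [withTwos, hl]

open Classical in
/-- The state of the induced chain for `B` below a state whose coordinates in `B` are positive. -/
def project (B : Finset (Fin d)) (a : L.State) : L.InducedState B :=
  ⟨fun l => a.1 l,
    if h : face a.1 = face (withTwos B fun l => a.1 l) then Fin.cast (congrArg L.s h) a.2
    -- A default value, not met when the coordinates in `B` are positive (`project_mk`).
    else ⟨0, L.s_pos _⟩⟩

theorem project_mk {B : Finset (Fin d)} {x : Fin d → ℕ} (hx : ∀ l ∈ B, x l ≠ 0)
    (i : Fin (L.s (face x))) : L.project B ⟨x, i⟩ =
      ⟨fun l => x l, Fin.cast (congrArg L.s (face_withTwos_restrict hx)) i⟩ := by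
  simp only [project]
  rw [dif_pos (face_withTwos_restrict hx)]

/-- The vector with all coordinates in `B` equal to `R` and the other coordinates those of `y`. -/
def withConst (B : Finset (Fin d)) (R : ℕ) (y : {l : Fin d // l ∉ B} → ℕ) : Fin d → ℕ :=
  fun l => if h : l ∈ B then R else y ⟨l, h⟩

theorem face_withConst (B : Finset (Fin d)) {R : ℕ} (hR : R ≠ 0) (y : {l : Fin d // l ∉ B} → ℕ) :
    face (withTwos B y) = face (withConst B R y) := by
  refine face_congr fun l => ?_
  by_cases hl : l ∈ B <;> simp [withTwos, withConst, hl, hR]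

theorem exists_project_eq {B : Finset (Fin d)} {R : ℕ} (hR : R ≠ 0) (b : L.InducedState B) :
    ∃ a : L.State, L.project B a = b ∧ (∀ l ∈ B, a.1 l = R) ∧ ∀ l : {l // l ∉ B}, a.1 l = b.1 l := by
  have h1 : ∀ l ∈ B, withConst B R b.1 l = R := fun l hl => by simp [withConst, hl]
  have h2 : ∀ l : {l // l ∉ B}, withConst B R b.1 l = b.1 l := fun l => by simp [withConst, l.2]
  refine ⟨⟨withConst B R b.1, Fin.cast (congrArg L.s (face_withConst B hR b.1)) b.2⟩, ?_, h1, h2⟩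
  rw [project_mk _ fun l hl => by rw [h1 l hl]; exact hR]
  exact L.inducedState_ext (funext h2) rfl

theorem project_withTwos {B : Finset (Fin d)} (b : L.InducedState B) :
    L.project B ⟨withTwos B b.1, b.2⟩ = b := by
  rw [project_mk _ fun l hl => by simp [withTwos, hl]]
  exact L.inducedState_ext (funext fun l => by simp [withTwos, l.2]) rfl

theorem sum_neighbors_eq {B : Finset (Fin d)} {x : Fin d → ℕ} (hx : ∀ l ∈ B, 2 ≤ x l)
    (G : (Fin d → ℕ) → ℝ) :
    ∑ y ∈ neighbors x, G y = ∑ y' ∈ neighbors (fun l : {l : Fin d // l ∉ B} => x l),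
      ∑ v ∈ Fintype.piFinset (fun _ : {l : Fin d // l ∈ B} => Finset.Icc (-1 : ℤ) 1),
        G fun l => if h : l ∈ B then (x l + v ⟨l, h⟩).toNat else y' ⟨l, h⟩ := by
  rw [← Finset.sum_product']
  refine Finset.sum_nbij' (fun y => (fun l => y l, fun l => (y l : ℤ) - x l))
    (fun q l => if h : l ∈ B then (x l + q.2 ⟨l, h⟩).toNat else q.1 ⟨l, h⟩) ?_ ?_ ?_ ?_ ?_
  · intro y hy
    rw [mem_neighbors] at hy
    simp only [Finset.mem_product, mem_neighbors, Fintype.mem_piFinset, Finset.mem_Icc]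
    exact ⟨fun l => hy l, fun l => by have := hy l; omega⟩
  · intro q hq
    simp only [Finset.mem_product, mem_neighbors, Fintype.mem_piFinset, Finset.mem_Icc] at hq
    rw [mem_neighbors]
    intro l
    by_cases hl : l ∈ B
    · have h1 := hq.2 ⟨l, hl⟩
      have h2 := hx l hl
      simp only [hl, dif_pos]
      omega
    · simpa [hl] using hq.1 ⟨l, hl⟩
  · intro y hy
    ext l
    by_cases hl : l ∈ B <;> simp [hl]
  · intro q hq
    simp only [Finset.mem_product, mem_neighbors, Fintype.mem_piFinset, Finset.mem_Icc] at hq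
    refine Prod.ext (funext fun l => by simp [l.2]) (funext fun l => ?_)
    have h1 := hq.2 l
    have h2 := hx l l.2
    simp only [l.2, dif_pos, Subtype.coe_eta]
    omega
  · intro y hy
    congr 1
    ext l
    by_cases hl : l ∈ B <;> simp [hl]

/-- Coordinates that are at least 2 stay positive after one step, so both faces are those seen by
the induced chain. The free `Φ` serves three purposes: row sums (`Φ = 1`), the operator (`Φ` a
function of the state) and mean increments (`Φ` a coordinate of the step). -/
theorem sum_step_project {B : Finset (Fin d)} {a : L.State} (ha : ∀ l ∈ B, 2 ≤ a.1 l)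
    (Φ : (Fin d → ℤ) → L.InducedState B → ℝ) :
    ∑ y ∈ neighbors a.1, ∑ j : Fin (L.s (face y)),
      (L.p (face a.1) (face y) (fun l => (y l : ℤ) - (a.1 l : ℤ)) a.2 j : ℝ) *
        Φ (fun l => (y l : ℤ) - (a.1 l : ℤ)) (L.project B ⟨y, j⟩) =
    ∑ y' ∈ neighbors (L.project B a).1, ∑ j : Fin (L.s (face (withTwos B y'))),
      ∑ v ∈ Fintype.piFinset (fun _ : {l : Fin d // l ∈ B} => Finset.Icc (-1 : ℤ) 1),
        (L.p (face (withTwos B (L.project B a).1)) (face (withTwos B y'))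
          (glue B v fun l => (y' l : ℤ) - ((L.project B a).1 l : ℤ)) (L.project B a).2 j : ℝ) *
        Φ (glue B v fun l => (y' l : ℤ) - ((L.project B a).1 l : ℤ)) ⟨y', j⟩ := by
  obtain ⟨x, i⟩ := a
  rw [L.project_mk fun l hl => by have := ha l hl; simp only at this; omega]
  simp only at ha ⊢
  rw [sum_neighbors_eq ha fun y => ∑ j : Fin (L.s (face y)),
    (L.p (face x) (face y) (fun l => (y l : ℤ) - (x l : ℤ)) i j : ℝ) *
        Φ (fun l => (y l : ℤ) - (x l : ℤ)) (L.project B ⟨y, j⟩)]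
  refine Finset.sum_congr rfl fun y' _ => ?_
  rw [Finset.sum_comm]
  refine Finset.sum_congr rfl fun v hv => ?_
  simp only [Fintype.mem_piFinset, Finset.mem_Icc] at hv
  set y : Fin d → ℕ := fun l => if h : l ∈ B then (x l + v ⟨l, h⟩).toNat else y' ⟨l, h⟩ with hy
  have hyB : ∀ l (hl : l ∈ B), (y l : ℤ) = x l + v ⟨l, hl⟩ := fun l hl => by
    have h1 := hv ⟨l, hl⟩
    have h2 := ha l hl
    simp only [hy, hl, dif_pos]
    omega
  have hy0 : ∀ l ∈ B, y l ≠ 0 := fun l hl => by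
    have h1 := hv ⟨l, hl⟩
    have h2 := ha l hl
    have h3 := hyB l hl
    omega
  have hy' : (fun l : {l : Fin d // l ∉ B} => y l) = y' := funext fun l => by simp [hy, l.2]
  have hz : (fun l => (y l : ℤ) - (x l : ℤ)) = glue B v fun l => (y' l : ℤ) - (x l : ℤ) := by
    ext l
    by_cases hl : l ∈ B
    · simp [glue, hl, hyB l hl]
    · simp [glue, hl, hy]
  have hface : face y = face (withTwos B y') := by
    rw [← hy']
    exact face_withTwos_restrict hy0
  rw [hz]
  refine Fintype.sum_equiv (finCongr (congrArg L.s hface)) _ _ fun j => ?_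
  have hp : L.project B ⟨y, j⟩ = ⟨y', finCongr (congrArg L.s hface) j⟩ := by
    rw [L.project_mk hy0]
    exact L.inducedState_ext hy' rfl
  rw [hp]
  congr 2
  exact (L.p_cast (face_withTwos_restrict fun l hl => by have := ha l hl; omega) hface _ i j).symm

/-! ### The chains are locally finite -/

theorem isLocallyFiniteChain_of_neighbors {ι : Type*} [Fintype ι] [DecidableEq ι]
    {β : (ι → ℕ) → Type*} [∀ x, Fintype (β x)] {P : (Σ x, β x) → (Σ x, β x) → ℝ≥0∞}
    (h0 : ∀ a b, b.1 ∉ neighbors a.1 → P a b = 0)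
    (h1 : ∀ a, ∑ y ∈ neighbors a.1, ∑ j : β y, P a ⟨y, j⟩ = 1) : IsLocallyFiniteChain P where
  tsum_eq_one a := by
    rw [← h1 a, Finset.sum_sigma' (neighbors a.1) (fun _ => Finset.univ) fun y j => P a ⟨y, j⟩]
    exact tsum_eq_sum fun b hb => h0 a b fun hn => hb (by simpa using hn)
  finite_succ a := by
    refine ((neighbors a.1).sigma fun _ => Finset.univ).finite_toSet.subset fun b hb => ?_
    by_contra h
    exact hb (h0 a b fun hn => h (by simpa using hn))
  finite_pred b := by
    refine ((neighbors b.1).sigma fun _ => Finset.univ).finite_toSet.subset fun a ha => ?_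
    by_contra h
    exact ha (h0 a b fun hn => h (by simpa using mem_neighbors_comm.mp hn))

theorem op_apply_of_neighbors {ι : Type*} [Fintype ι] [DecidableEq ι]
    {β : (ι → ℕ) → Type*} [∀ x, Fintype (β x)] {P : (Σ x, β x) → (Σ x, β x) → ℝ≥0∞}
    (h0 : ∀ a b, b.1 ∉ neighbors a.1 → P a b = 0) (hP : IsLocallyFiniteChain P)
    (g : (Σ x, β x) → ℝ) (a : Σ x, β x) :
    hP.op g a = ∑ y ∈ neighbors a.1, ∑ j : β y, (P a ⟨y, j⟩).toReal * g ⟨y, j⟩ := by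
  rw [hP.op_apply g a (t := (neighbors a.1).sigma fun _ => Finset.univ), Finset.sum_sigma]
  intro b hb
  by_contra h
  exact hb (h0 a b fun hn => h (by simpa using hn))

theorem transition_eq_zero (a b : L.State) (h : b.1 ∉ neighbors a.1) : L.transition a b = 0 :=
  if_neg h

theorem inducedTransition_eq_zero {B : Finset (Fin d)} (a b : L.InducedState B)
    (h : b.1 ∉ neighbors a.1) : L.inducedTransition B a b = 0 :=
  if_neg h

theorem isLocallyFiniteChain_transition : IsLocallyFiniteChain L.transition := by
  refine isLocallyFiniteChain_of_neighbors L.transition_eq_zero fun a => ?_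
  have h := L.sum_eq_one a.1 a.2
  rw [← ENNReal.coe_one, ← h]
  push_cast
  refine Finset.sum_congr rfl fun y hy => Finset.sum_congr rfl fun j _ => ?_
  simp [transition, hy]

theorem isLocallyFiniteChain_inducedTransition (B : Finset (Fin d)) :
    IsLocallyFiniteChain (L.inducedTransition B) := by
  refine isLocallyFiniteChain_of_neighbors L.inducedTransition_eq_zero fun b => ?_
  have h := L.sum_step_project (B := B) (a := ⟨withTwos B b.1, b.2⟩)
    (fun l hl => by simp [withTwos, hl]) fun _ _ => 1
  rw [L.project_withTwos] at h
  have h1 := L.sum_eq_one (withTwos B b.1) b.2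
  simp only [mul_one] at h
  have h2 : ∑ y' ∈ neighbors b.1, ∑ j : Fin (L.s (face (withTwos B y'))),
      ∑ v ∈ Fintype.piFinset (fun _ : {l : Fin d // l ∈ B} => Finset.Icc (-1 : ℤ) 1),
        L.p (face (withTwos B b.1)) (face (withTwos B y'))
          (glue B v fun l => (y' l : ℤ) - (b.1 l : ℤ)) b.2 j = 1 := by
    rw [← h1]
    apply NNReal.coe_injective
    push_cast
    exact h.symm
  rw [← ENNReal.coe_one, ← h2]
  push_cast
  refine Finset.sum_congr rfl fun y hy => Finset.sum_congr rfl fun j _ => ?_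
  simp [inducedTransition, hy]

/-- The transition operator of the walk. -/
theorem op_transition_apply (g : L.State → ℝ) (a : L.State) :
    L.isLocallyFiniteChain_transition.op g a = ∑ y ∈ neighbors a.1, ∑ j : Fin (L.s (face y)),
      (L.p (face a.1) (face y) (fun l => (y l : ℤ) - (a.1 l : ℤ)) a.2 j : ℝ) * g ⟨y, j⟩ := by
  rw [op_apply_of_neighbors L.transition_eq_zero]
  refine Finset.sum_congr rfl fun y hy => Finset.sum_congr rfl fun j _ => ?_
  simp [transition, hy]

theorem op_inducedTransition_apply {B : Finset (Fin d)} (g : L.InducedState B → ℝ)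
    (b : L.InducedState B) : (L.isLocallyFiniteChain_inducedTransition B).op g b =
      ∑ y ∈ neighbors b.1, ∑ j : Fin (L.s (face (withTwos B y))),
      ∑ v ∈ Fintype.piFinset (fun _ : {l : Fin d // l ∈ B} => Finset.Icc (-1 : ℤ) 1),
        (L.p (face (withTwos B b.1)) (face (withTwos B y))
          (glue B v fun l => (y l : ℤ) - (b.1 l : ℤ)) b.2 j : ℝ) * g ⟨y, j⟩ := by
  rw [op_apply_of_neighbors L.inducedTransition_eq_zero]
  refine Finset.sum_congr rfl fun y hy => Finset.sum_congr rfl fun j _ => ?_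
  rw [← Finset.sum_mul]
  congr 1
  simp only [inducedTransition, hy, if_true]
  rw [ENNReal.toReal_sum (by simp)]
  simp

theorem op_comp_project {B : Finset (Fin d)} (g : L.InducedState B → ℝ) {a : L.State}
    (ha : ∀ l ∈ B, 2 ≤ a.1 l) :
    L.isLocallyFiniteChain_transition.op (g ∘ L.project B) a =
      (L.isLocallyFiniteChain_inducedTransition B).op g (L.project B a) := by
  rw [L.op_transition_apply, L.op_inducedTransition_apply]
  exact L.sum_step_project ha fun _ b => g b

theorem meanStep_eq {a : L.State} (l : Fin d) : L.meanStep a l =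
    L.isLocallyFiniteChain_transition.op (fun b => (b.1 l : ℝ)) a - a.1 l := by
  have h : (a.1 l : ℝ) = L.isLocallyFiniteChain_transition.op (fun _ => (a.1 l : ℝ)) a := by
    rw [IsLocallyFiniteChain.op_const]
  rw [h, ← Pi.sub_apply, ← map_sub, L.op_transition_apply, meanStep]
  refine Finset.sum_congr rfl fun y hy => Finset.sum_congr rfl fun j _ => ?_
  rw [mul_comm, Pi.sub_apply]

theorem abs_meanStep_le (a : L.State) (l : Fin d) : |L.meanStep a l| ≤ 1 := by
  have hc := fun c : ℝ => congrFun (L.isLocallyFiniteChain_transition.op_const c) a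
  have hmem : ∀ b, L.transition a b ≠ 0 → (a.1 l : ℝ) ≤ b.1 l + 1 ∧ (b.1 l : ℝ) ≤ a.1 l + 1 := by
    intro b hb
    have h : b.1 ∈ neighbors a.1 := by
      by_contra h
      exact hb (L.transition_eq_zero a b h)
    have := mem_neighbors.mp h l
    exact_mod_cast this
  rw [meanStep_eq, abs_le]
  constructor
  · have h := L.isLocallyFiniteChain_transition.op_le_op (g := fun _ => (a.1 l : ℝ) - 1)
      (h := fun b => (b.1 l : ℝ)) (s := a) fun b hb => by linarith [(hmem b hb).1]
    rw [hc] at h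
    linarith
  · have h := L.isLocallyFiniteChain_transition.op_le_op (h := fun _ => (a.1 l : ℝ) + 1)
      (g := fun b => (b.1 l : ℝ)) (s := a) fun b hb => by linarith [(hmem b hb).2]
    rw [hc] at h
    linarith

theorem meanStep_eq_of_project {B : Finset (Fin d)} {a : L.State} (ha : ∀ l ∈ B, 2 ≤ a.1 l)
    (l : Fin d) : L.meanStep ⟨withTwos B (L.project B a).1, (L.project B a).2⟩ l =
      L.meanStep a l := by
  have key : ∀ c : L.State, L.meanStep c l = ∑ y ∈ neighbors c.1, ∑ j : Fin (L.s (face y)),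
      (L.p (face c.1) (face y) (fun k => (y k : ℤ) - (c.1 k : ℤ)) c.2 j : ℝ) *
        (((fun k => (y k : ℤ) - (c.1 k : ℤ)) l : ℤ) : ℝ) := by
    intro c
    refine Finset.sum_congr rfl fun y hy => Finset.sum_congr rfl fun j _ => ?_
    push_cast
    ring
  rw [key, key, L.sum_step_project ha fun z _ => (z l : ℝ),
    L.sum_step_project (B := B) (a := ⟨withTwos B (L.project B a).1, (L.project B a).2⟩)
      (fun l hl => by simp [withTwos, hl]) fun z _ => (z l : ℝ), L.project_withTwos]

end MMRRW

namespace MMRRW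

variable {d : ℕ} (L : MMRRW d)

/-! ### Comparison of the walk with the induced chains over several steps -/

theorem op_pow_le_of_near (n : ℕ) {g h : L.State → ℝ} {a : L.State}
    (hgh : ∀ b : L.State, (∀ l, a.1 l ≤ b.1 l + n ∧ b.1 l ≤ a.1 l + n) → g b ≤ h b) :
    (L.isLocallyFiniteChain_transition.op ^ n) g a ≤
      (L.isLocallyFiniteChain_transition.op ^ n) h a := by
  induction n generalizing a with
  | zero => exact hgh a fun l => ⟨le_rfl, le_rfl⟩
  | succ n ih =>
    rw [pow_succ', Module.End.mul_apply, Module.End.mul_apply]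
    refine L.isLocallyFiniteChain_transition.op_le_op fun b hb => ih fun c hc => hgh c fun l => ?_
    have h : b.1 ∈ neighbors a.1 := by
      by_contra h
      exact hb (L.transition_eq_zero a b h)
    have h1 := mem_neighbors.mp h l
    have h2 := hc l
    omega

theorem op_pow_congr_of_near (n : ℕ) {g h : L.State → ℝ} {a : L.State}
    (hgh : ∀ b : L.State, (∀ l, a.1 l ≤ b.1 l + n ∧ b.1 l ≤ a.1 l + n) → g b = h b) :
    (L.isLocallyFiniteChain_transition.op ^ n) g a =
      (L.isLocallyFiniteChain_transition.op ^ n) h a :=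
  le_antisymm (L.op_pow_le_of_near n fun b hb => (hgh b hb).le)
    (L.op_pow_le_of_near n fun b hb => (hgh b hb).ge)

/-- Each coordinate falls by at most 1 per step, so height `n + 1` leaves at least 2 before every
one of the `n` steps. -/
theorem op_pow_comp_project {B : Finset (Fin d)} (n : ℕ) (g : L.InducedState B → ℝ) {a : L.State}
    (ha : ∀ l ∈ B, n + 1 ≤ a.1 l) :
    (L.isLocallyFiniteChain_transition.op ^ n) (g ∘ L.project B) a =
      ((L.isLocallyFiniteChain_inducedTransition B).op ^ n) g (L.project B a) := by
  induction n generalizing g with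
  | zero => rfl
  | succ n ih =>
    rw [pow_succ, pow_succ, Module.End.mul_apply, Module.End.mul_apply,
      ← ih _ fun l hl => by have := ha l hl; omega]
    refine L.op_pow_congr_of_near n fun b hb => L.op_comp_project g fun l hl => ?_
    have h1 := ha l hl
    have h2 := hb l
    omega

/-- The scalar product of the conditional mean increment with the `j`-th column of `U`. -/
def colDrift (U : Matrix (Fin d) (Fin d) ℝ) (j : Fin d) (a : L.State) : ℝ :=
  ∑ l, L.meanStep a l * U l j

/-- The function `colDrift` on the state space of an induced chain. -/
def inducedColDrift (U : Matrix (Fin d) (Fin d) ℝ) (B : Finset (Fin d)) (j : Fin d)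
    (b : L.InducedState B) : ℝ :=
  L.colDrift U j ⟨withTwos B b.1, b.2⟩

variable {U : Matrix (Fin d) (Fin d) ℝ}

theorem abs_colDrift_le (j : Fin d) (a : L.State) : |L.colDrift U j a| ≤ ∑ l, |U l j| := by
  refine (Finset.abs_sum_le_sum_abs _ _).trans (Finset.sum_le_sum fun l _ => ?_)
  rw [abs_mul]
  exact mul_le_of_le_one_left (abs_nonneg _) (L.abs_meanStep_le a l)

theorem pot_colDrift_eq {B : Finset (Fin d)} (T : ℕ) (j : Fin d) {a : L.State}
    (ha : ∀ l ∈ B, T + 1 ≤ a.1 l) :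
    L.isLocallyFiniteChain_transition.pot T (L.colDrift U j) a =
      (L.isLocallyFiniteChain_inducedTransition B).pot T (L.inducedColDrift U B j)
        (L.project B a) := by
  rw [IsLocallyFiniteChain.pot_apply, IsLocallyFiniteChain.pot_apply]
  refine Finset.sum_congr rfl fun t ht => ?_
  have htT := Finset.mem_range.mp ht
  rw [← L.op_pow_comp_project t _ fun l hl => by have := ha l hl; omega]
  refine L.op_pow_congr_of_near t fun b hb => ?_
  have hb2 : ∀ l ∈ B, 2 ≤ b.1 l := fun l hl => by
    have h1 := ha l hl
    have h2 := hb l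
    omega
  simp only [Function.comp, inducedColDrift, colDrift, L.meanStep_eq_of_project hb2]

theorem finite_setOf_induced_le (B : Finset (Fin d)) (R : ℕ) :
    {b : L.InducedState B | ∀ l, b.1 l ≤ R}.Finite := by
  refine ((Fintype.piFinset fun _ => Finset.range (R + 1)).sigma
    fun _ => Finset.univ).finite_toSet.subset fun b hb => ?_
  simpa [Nat.lt_succ_iff] using hb

theorem finite_setOf_le (R : ℕ) : {a : L.State | ∀ l, a.1 l ≤ R}.Finite := by
  refine ((Fintype.piFinset fun _ => Finset.range (R + 1)).sigma
    fun _ => Finset.univ).finite_toSet.subset fun b hb => ?_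
  simpa [Nat.lt_succ_iff] using hb

theorem tsum_inducedColDrift_mul {B : Finset (Fin d)}
    (hπ : IsStationaryDist (L.inducedTransition B) (stationaryDist (L.inducedTransition B)))
    (j : Fin d) :
    ∑' b, L.inducedColDrift U B j b * (stationaryDist (L.inducedTransition B) b).toReal =
      ∑ l, L.meanIncrement B l * U l j := by
  simp only [inducedColDrift, colDrift, meanIncrement, Finset.sum_mul, ← tsum_mul_right]
  rw [Summable.tsum_finsetSum]
  · refine Finset.sum_congr rfl fun l _ => tsum_congr fun b => by ring
  · intro l _
    refine ((IsLocallyFiniteChain.summable_toReal_of_stationary hπ (C := 1)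
      (g := fun b => L.meanStep ⟨withTwos B b.1, b.2⟩ l)
      fun b => L.abs_meanStep_le _ l).mul_right (U l j)).congr fun b => by ring

/-- Descending induction on the size of `B`. The form "for all large `T`" allows one `T` to serve
all larger sets simultaneously. For `B` the full set there is no larger set and the induced chain is
finite, so the base case is included. -/
theorem eventually_pot_inducedColDrift_le
    (hind : ∀ A : Finset (Fin d), A.Nonempty → IsIrreducibleChain (L.inducedTransition A))
    (hU : ∀ A ∈ L.positiveRecurrentFaces, ∀ j ∈ A, ∑ l, L.meanIncrement A l * U l j < 0)
    (B : Finset (Fin d)) (hB : B.Nonempty) :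
    ∀ᶠ T : ℕ in Filter.atTop, ∀ j ∈ B, ∀ b,
      (L.isLocallyFiniteChain_inducedTransition B).pot T (L.inducedColDrift U B j) b ≤ -1 := by
  induction hk : d - B.card using Nat.strong_induction_on generalizing B with
  | _ k ih =>
    have hlarger : ∀ᶠ T : ℕ in Filter.atTop, ∀ A : Finset (Fin d), B ⊂ A → ∀ j ∈ A, ∀ b,
        (L.isLocallyFiniteChain_inducedTransition A).pot T (L.inducedColDrift U A j) b ≤ -1 := by
      rw [Filter.eventually_all]
      intro A
      by_cases hA : B ⊂ A
      · have h1 := Finset.card_lt_card hA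
        have h2 : A.card ≤ d := by simpa using A.card_le_univ
        filter_upwards [ih (d - A.card) (by omega) A (hB.mono hA.subset) rfl] with T hT _
        exact hT
      · exact Filter.Eventually.of_forall fun T h => absurd h hA
    obtain ⟨T, hT, hT0⟩ := (hlarger.and (Filter.eventually_gt_atTop 0)).exists
    have hP := L.isLocallyFiniteChain_inducedTransition B
    refine (Finset.eventually_all B).mpr fun j hj => ?_
    have hF : ∀ b ∉ (L.finite_setOf_induced_le B T).toFinset,
        hP.pot T (L.inducedColDrift U B j) b ≤ -1 := by
      intro b hb
      simp only [Set.Finite.mem_toFinset, Set.mem_ofPred_eq, not_forall, not_le] at hb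
      obtain ⟨l, hl⟩ := hb
      -- Lift `b` to a state of the walk with height `T + 1` in `B`. The set `A` of all its
      -- coordinates above `T` strictly contains `B`, so the drift at `b` equals a drift for the
      -- induced chain of `A`.
      obtain ⟨a, hab, haB, hal⟩ := L.exists_project_eq T.succ_ne_zero b
      rw [← hab, ← L.pot_colDrift_eq T j fun l hl => (haB l hl).ge]
      set A := Finset.univ.filter fun l => T + 1 ≤ a.1 l
      have hBA : B ⊆ A := fun l hl => by simp [A, haB l hl]
      have hlA : (l : Fin d) ∈ A := by simpa [A, hal l] using hl
      rw [L.pot_colDrift_eq (B := A) T j fun l hl => by simpa [A] using hl]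
      exact hT A ((Finset.ssubset_iff_of_subset hBA).mpr ⟨l, hlA, l.2⟩) j (hBA hj) _
    obtain ⟨δ, hδ, K, hK⟩ := hP.exists_pot_le (hind B hB)
      (fun b => L.abs_colDrift_le j _) hT0 _ hF fun hpr hπ => by
        rw [L.tsum_inducedColDrift_mul hπ]
        exact hU B ⟨hB, hpr⟩ j hj
    have hlim : Filter.Tendsto (fun n : ℕ => δ * (n : ℝ)) Filter.atTop Filter.atTop :=
      tendsto_natCast_atTop_atTop.const_mul_atTop hδ
    filter_upwards [hlim.eventually_ge_atTop (K + 1)] with n hn b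
    linarith [hK n b]

/-! ### The quadratic test function -/

/-- The quadratic form `⟨x, U x⟩` on the state space. -/
def quadForm (U : Matrix (Fin d) (Fin d) ℝ) (a : L.State) : ℝ :=
  ∑ j, ∑ l, (a.1 l : ℝ) * U l j * a.1 j

theorem quadForm_nonneg (hU : U.PosDef) (a : L.State) : 0 ≤ L.quadForm U a := by
  have h := hU.posSemidef.dotProduct_mulVec_nonneg fun l => (a.1 l : ℝ)
  simp only [dotProduct, Matrix.mulVec, Finset.mul_sum] at h
  rw [quadForm, Finset.sum_comm]
  refine h.trans_eq (Finset.sum_congr rfl fun l _ => Finset.sum_congr rfl fun j _ => ?_)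
  simp [mul_assoc]

/-- Second-order expansion: symmetry of `U` merges the two cross terms, and the quadratic remainder
is bounded because no coordinate moves by more than `T`. -/
theorem quadForm_le (hU : U.IsHermitian) {T : ℕ} {a b : L.State}
    (hab : ∀ l, a.1 l ≤ b.1 l + T ∧ b.1 l ≤ a.1 l + T) :
    L.quadForm U b ≤ L.quadForm U a + T ^ 2 * ∑ j, ∑ l, |U l j| +
      ∑ j, 2 * (a.1 j : ℝ) * ∑ l, U l j * ((b.1 l : ℝ) - a.1 l) := by
  have hz : ∀ l, |(b.1 l : ℝ) - a.1 l| ≤ T := by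
    intro l
    have h1 : (a.1 l : ℝ) ≤ b.1 l + T := by exact_mod_cast (hab l).1
    have h2 : (b.1 l : ℝ) ≤ a.1 l + T := by exact_mod_cast (hab l).2
    rw [abs_le]
    constructor <;> linarith
  have hsymm : ∀ j l, U l j = U j l := fun j l => by
    simpa using hU.apply j l
  have hswap : ∑ j, ∑ l, (a.1 l : ℝ) * U l j * ((b.1 j : ℝ) - a.1 j) =
      ∑ j, ∑ l, (a.1 j : ℝ) * U l j * ((b.1 l : ℝ) - a.1 l) := by
    rw [Finset.sum_comm]
    refine Finset.sum_congr rfl fun j _ => Finset.sum_congr rfl fun l _ => ?_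
    rw [hsymm l j]
  have hquad : ∑ j, ∑ l, ((b.1 l : ℝ) - a.1 l) * U l j * ((b.1 j : ℝ) - a.1 j) ≤
      T ^ 2 * ∑ j, ∑ l, |U l j| := by
    simp only [Finset.mul_sum]
    refine Finset.sum_le_sum fun j _ => Finset.sum_le_sum fun l _ => ?_
    refine (le_abs_self _).trans ?_
    rw [abs_mul, abs_mul]
    have h := mul_le_mul (hz l) (hz j) (abs_nonneg _) (Nat.cast_nonneg T)
    nlinarith [mul_le_mul_of_nonneg_right h (abs_nonneg (U l j))]
  have hexp : L.quadForm U b = L.quadForm U a +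
      (∑ j, ∑ l, ((b.1 l : ℝ) - a.1 l) * U l j * ((b.1 j : ℝ) - a.1 j) +
      (∑ j, ∑ l, (a.1 l : ℝ) * U l j * ((b.1 j : ℝ) - a.1 j) +
        ∑ j, ∑ l, (a.1 j : ℝ) * U l j * ((b.1 l : ℝ) - a.1 l))) := by
    simp only [quadForm, ← Finset.sum_add_distrib]
    refine Finset.sum_congr rfl fun j _ => Finset.sum_congr rfl fun l _ => ?_
    ring
  have hlin : ∑ j, 2 * (a.1 j : ℝ) * ∑ l, U l j * ((b.1 l : ℝ) - a.1 l) =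
      2 * ∑ j, ∑ l, (a.1 j : ℝ) * U l j * ((b.1 l : ℝ) - a.1 l) := by
    simp only [Finset.mul_sum, mul_assoc]
  rw [hexp, hswap, hlin]
  linarith

theorem op_pow_coord (T : ℕ) (a : L.State) (l : Fin d) :
    (L.isLocallyFiniteChain_transition.op ^ T) (fun b => (b.1 l : ℝ) - a.1 l) a =
      L.isLocallyFiniteChain_transition.pot T (fun b => L.meanStep b l) a := by
  have h1 : (fun b => L.meanStep b l) =
      L.isLocallyFiniteChain_transition.op (fun b => (b.1 l : ℝ)) - fun b => (b.1 l : ℝ) :=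
    funext fun b => L.meanStep_eq l
  have h2 : (fun b : L.State => (b.1 l : ℝ) - a.1 l) =
      (fun b => (b.1 l : ℝ)) - fun _ => (a.1 l : ℝ) := rfl
  rw [h1, IsLocallyFiniteChain.pot_op_sub, h2, map_sub, IsLocallyFiniteChain.op_pow_const]
  rfl

theorem pot_colDrift (T : ℕ) (j : Fin d) (a : L.State) :
    L.isLocallyFiniteChain_transition.pot T (L.colDrift U j) a =
      ∑ l, U l j * L.isLocallyFiniteChain_transition.pot T (fun b => L.meanStep b l) a := by
  have h : L.colDrift U j = ∑ l, U l j • fun b => L.meanStep b l := by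
    ext b
    simp [colDrift, mul_comm]
  rw [h, map_sum, Finset.sum_apply]
  simp

theorem op_pow_quadForm_le (hU : U.IsHermitian) (T : ℕ) (a : L.State) :
    (L.isLocallyFiniteChain_transition.op ^ T) (L.quadForm U) a ≤
      L.quadForm U a + T ^ 2 * ∑ j, ∑ l, |U l j| +
      ∑ j, 2 * (a.1 j : ℝ) * L.isLocallyFiniteChain_transition.pot T (L.colDrift U j) a := by
  refine (L.op_pow_le_of_near T fun b hb => L.quadForm_le hU hb).trans (le_of_eq ?_)
  have h : (fun b : L.State => L.quadForm U a + T ^ 2 * ∑ j, ∑ l, |U l j| +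
      ∑ j, 2 * (a.1 j : ℝ) * ∑ l, U l j * ((b.1 l : ℝ) - a.1 l)) =
      (fun _ => L.quadForm U a + T ^ 2 * ∑ j, ∑ l, |U l j|) +
      ∑ j, (2 * (a.1 j : ℝ)) • ∑ l, U l j • fun b : L.State => (b.1 l : ℝ) - a.1 l := by
    ext b
    simp [Finset.sum_apply]
  rw [h, map_add, IsLocallyFiniteChain.op_pow_const, map_sum, Pi.add_apply, Finset.sum_apply]
  congr 1
  refine Finset.sum_congr rfl fun j _ => ?_
  rw [map_smul, map_sum, Pi.smul_apply, Finset.sum_apply, smul_eq_mul, L.pot_colDrift]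
  congr 1
  refine Finset.sum_congr rfl fun l _ => ?_
  rw [map_smul, Pi.smul_apply, L.op_pow_coord, smul_eq_mul]

end MMRRW

/-! ### The drift of the quadratic form and the conclusion -/

theorem mainTheorem1 (d : ℕ) (hd : 0 < d) (L : MMRRW d)
    (hirr : IsIrreducibleChain L.transition)
    (hind : ∀ A : Finset (Fin d), A.Nonempty → IsIrreducibleChain (L.inducedTransition A))
    (hU : L.feasibleMatrices.Nonempty) :
    IsPositiveRecurrentChain L.transition := by
  obtain ⟨U, hpos, hU⟩ := hU
  have hP := L.isLocallyFiniteChain_transition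
  obtain ⟨T, hT⟩ : ∃ T : ℕ, ∀ B : Finset (Fin d), B.Nonempty → ∀ j ∈ B, ∀ b,
      (L.isLocallyFiniteChain_inducedTransition B).pot T (L.inducedColDrift U B j) b ≤ -1 := by
    refine (Filter.eventually_all.mpr fun B => ?_ : ∀ᶠ T : ℕ in Filter.atTop, _).exists
    by_cases hB : B.Nonempty
    · exact (L.eventually_pot_inducedColDrift_le hind hU B hB).mono fun T h _ => h
    · exact Filter.Eventually.of_forall fun T h => absurd h hB
  set M : ℝ := ∑ j, ∑ l, |U l j|
  have hMj : ∀ j, ∑ l, |U l j| ≤ M := fun j =>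
    Finset.single_le_sum (f := fun j => ∑ l, |U l j|)
      (fun j _ => Finset.sum_nonneg fun l _ => abs_nonneg _) (Finset.mem_univ j)
  have hM : 0 ≤ M := Finset.sum_nonneg fun j _ => Finset.sum_nonneg fun l _ => abs_nonneg _
  -- Each coordinate adds at most `2 * T ^ 2 * M` to the drift, the remainder at most `T ^ 2 * M`,
  -- and a coordinate above `R` contributes a further `-R`; the 1 is the required decrease. The last
  -- `T` ensures that such a coordinate also exceeds `T`.
  obtain ⟨R, hR⟩ := exists_nat_ge (2 * d * (T ^ 2 * M) + T ^ 2 * M + 1 + T)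
  refine hP.isPositiveRecurrentChain_of_drift hirr (L.quadForm_nonneg hpos) T
    (L.finite_setOf_le R).toFinset fun a ha => ?_
  simp only [Set.Finite.mem_toFinset, Set.mem_ofPred_eq, not_forall, not_le] at ha
  obtain ⟨i, hi⟩ := ha
  have hTM : 0 ≤ (T : ℝ) ^ 2 * M := by positivity
  have hiR : (R : ℝ) ≤ a.1 i := by exact_mod_cast hi.le
  have hd0 : 0 ≤ 2 * (d : ℝ) * (T ^ 2 * M) := by positivity
  have hlarge : ∀ j, T + 1 ≤ a.1 j → hP.pot T (L.colDrift U j) a ≤ -1 := by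
    intro j hj
    -- Taking all coordinates above `T` as the set `B` puts `j` in `B`, so the uniform bound `hT`
    -- applies.
    rw [L.pot_colDrift_eq (B := Finset.univ.filter fun l => T + 1 ≤ a.1 l) T j
      fun l hl => by simpa using hl]
    exact hT _ ⟨j, by simpa using hj⟩ j (by simpa using hj) _
  have hiT : T + 1 ≤ a.1 i := by
    have : (T : ℝ) ≤ R := by linarith
    have : T ≤ R := by exact_mod_cast this
    omega
  have hterm : ∀ j, 2 * (a.1 j : ℝ) * hP.pot T (L.colDrift U j) a ≤
      2 * (T ^ 2 * M) - if j = i then (R : ℝ) else 0 := by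
    intro j
    have haj : (0 : ℝ) ≤ a.1 j := Nat.cast_nonneg _
    rcases le_or_gt (T + 1) (a.1 j) with hj | hj
    · have h1 := mul_le_mul_of_nonneg_left (hlarge j hj) haj
      split_ifs with hji
      · subst hji
        linarith
      · linarith
    · rw [if_neg (by rintro rfl; omega)]
      have h1 := (abs_le.mp (hP.abs_pot_le T (L.abs_colDrift_le (U := U) j) a)).2
      have h2 : (a.1 j : ℝ) ≤ T := by exact_mod_cast Nat.lt_succ_iff.mp hj
      have h3 : hP.pot T (L.colDrift U j) a ≤ T * M :=
        h1.trans (mul_le_mul_of_nonneg_left (hMj j) (Nat.cast_nonneg T))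
      have h4 := mul_le_mul_of_nonneg_left h3 haj
      have h5 := mul_le_mul_of_nonneg_right h2 (by positivity : 0 ≤ T * M)
      linarith
  have hsum := Finset.sum_le_sum fun j (_ : j ∈ Finset.univ) => hterm j
  rw [Finset.sum_sub_distrib, Finset.sum_ite_eq' Finset.univ i] at hsum
  simp only [Finset.sum_const, Finset.card_univ, Fintype.card_fin, nsmul_eq_mul,
    Finset.mem_univ, if_true] at hsum
  have hmain := L.op_pow_quadForm_le hpos.isHermitian T a
  have hT0 : (0 : ℝ) ≤ T := Nat.cast_nonneg T
  linarith
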